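/- Let $d\ge 1$. For $R>0$ let $\mathcal E(R)$ be the set of tempered distributions on $\mathbb R^d$ whose Fourier transform (normalized by $\widehat f(\xi)=\int f(x)e^{-2\pi i\langle x,\xi\rangle}dx$) is supported in $\{|\xi|\le 2R\}$; such distributions are functions. Let $\mathcal D$ be the set of dyadic cubes in $\mathbb R^d$, and write $l(P)$ and $|P|$ for the side length and the volume of a cube $P$. For $\mu\in\mathbb Z$, $0<q<\infty$ and a sequence $\mathbf f=\{f_k\}_{k\in\mathbb Z}$ put $$\mathcal V_{\mu,q}[\mathbf f]:=\sup_{P\in\mathcal D,\ l(P)\le 2^{-\mu}}\Big(\frac1{|P|}\int_P\sum_{k=-\log_2 l(P)}^\infty|f_k(x)|^q\,dx\Big)^{1/q}\in[0,\infty].$$ (1) For all $A>0$ and $0<q_1<q_2<\infty$ there is a finite constant $C=C(d,A,q_1,q_2)$ such that $\mathcal V_{\mu,q_2}[\mathbf f]\le C\,\mathcal V_{\mu,q_1}[\mathbf f]$ for all $\mu\in\mathbb Z$ and all sequences $\mathbf f$ with $f_k\in\mathcal E(A2^k)$ for every $k\in\mathbb Z$. (2) For all $A>0$ and $0<q<\infty$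 there is a finite constant $C=C(d,A,q)$ such that $\sup_{k\ge\mu}\|f_k\|_{L^\infty}\le C\,\mathcal V_{\mu,q}[\mathbf f]$ for all $\mu\in\mathbb Z$ and all such $\mathbf f$. (3) Let $\phi$ be a Schwartz function such that $\widehat\phi$ is supported in $\{1/2\le|\xi|\le 2\}$ and $\sum_{k\in\mathbb Z}\widehat{\phi_k}(\xi)=1$ for $\xi\ne0$, where $\phi_k:=2^{kd}\phi(2^k\cdot)$, and let $\widehat\Phi:=1-\sum_{k\ge1}\widehat{\phi_k}$. Put $\Lambda_0f:=\Phi*f$ and $\Lambda_kf:=\phi_k*f$ for $k\ge1$. For $s\in\mathbb R$ let $F_\infty^{s,q}$ be the space of tempered distributions $f$ with $\|f\|_{F_\infty^{s,q}}<\infty$, where $$\|f\|_{F_\infty^{s,q}}:=\|\Lambda_0f\|_{L^\infty}+\sup_{P\in\mathcal D,\ l(P)<1}\Big(\frac1{|P|}\int_P\sum_{k=-\log_2l(P)}^\infty2^{skq}|\Lambda_kf(x)|^q\,dx\Big)^{1/q}\quad(0<q<\infty),$$ $$\|f\|_{F_\infty^{s,\infty}}:=\big\|\sup_{k\ge0}2^{sk}|\Lambda_kf|\big\|_{L^\infty}.$$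 Then for all $s\in\mathbb R$ and $0<q_1<q_2\le\infty$ one has $F_\infty^{s,q_1}\hookrightarrow F_\infty^{s,q_2}$: that is, $F_\infty^{s,q_1}\subset F_\infty^{s,q_2}$, and there is a finite constant $C$ with $\|f\|_{F_\infty^{s,q_2}}\le C\|f\|_{F_\infty^{s,q_1}}$ for all tempered distributions $f$. -/

import Mathlib

open MeasureTheory SchwartzMap FourierTransform
open scoped ENNReal NNReal

noncomputable section

namespace TriebelLizorkinInfty

/-- The Euclidean space `ℝ^d`. -/
abbrev E (d : ℕ) : Type := EuclideanSpace ℝ (Fin d)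

/-- The half-open dyadic cube `∏ᵢ [2^{-k} nᵢ, 2^{-k} (nᵢ + 1))`, of side length `2^{-k}`. -/
def dyadicCube {d : ℕ} (k : ℤ) (n : Fin d → ℤ) : Set (E d) :=
  {x | ∀ i, (2 : ℝ) ^ (-k) * (n i : ℝ) ≤ x i ∧ x i < (2 : ℝ) ^ (-k) * ((n i : ℝ) + 1)}

/-- `𝓔(R)`: the tempered distributions whose Fourier transform is supported in
`{ξ : |ξ| ≤ 2 R}`. -/
def bandLimited (d : ℕ) (R : ℝ) : Set 𝓢'(E d, ℂ) :=
  {T | Distribution.dsupport (𝓕 T : 𝓢'(E d, ℂ)) ⊆ Metric.closedBall (0 : E d) (2 * R)}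

/-- The tempered distribution `T` is given by integration against the function `f`. -/
def IsRepresentedBy {d : ℕ} (T : 𝓢'(E d, ℂ)) (f : E d → ℂ) : Prop :=
  ∀ φ : 𝓢(E d, ℂ), Integrable (fun x => φ x * f x) ∧ T φ = ∫ x, φ x * f x

/-- `V_{μ,q}[f] = sup_{P dyadic, l(P) ≤ 2^{-μ}}
  ( |P|⁻¹ ∫_P ∑_{k ≥ -log₂ l(P)} |f_k(x)|^q dx )^{1/q}`, with values in `[0, ∞]`.
The cube `P = dyadicCube j n` has `-log₂ l(P) = j`. -/
def V {d : ℕ} (μ : ℤ) (q : ℝ) (f : ℤ → E d → ℂ) : ℝ≥0∞ :=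
  ⨆ (j : ℤ) (_ : μ ≤ j) (n : Fin d → ℤ),
    (⨍⁻ x in dyadicCube j n, ∑' k : Set.Ici j, ‖f k x‖ₑ ^ q ∂volume) ^ (1 / q)

/-- Multiplication by `2^k` as a linear automorphism of `ℝ^d`. -/
def dilation (d : ℕ) (k : ℤ) : E d ≃L[ℝ] E d :=
  ContinuousLinearEquiv.smulLeft (Units.mk0 ((2 : ℝ) ^ k) (zpow_ne_zero k two_ne_zero))

/-- `φ_k = 2^{kd} φ(2^k ·)`. -/
def dilate {d : ℕ} (k : ℤ) (φ : 𝓢(E d, ℂ)) : 𝓢(E d, ℂ) :=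
  ((2 : ℝ) ^ (k * (d : ℤ))) • compCLMOfContinuousLinearEquiv ℂ (dilation d k) φ

theorem dilate_apply {d : ℕ} (k : ℤ) (φ : 𝓢(E d, ℂ)) (x : E d) :
    dilate k φ x = ((2 : ℝ) ^ (k * (d : ℤ))) • φ (((2 : ℝ) ^ k) • x) := rfl

/-- For fixed `x`, the Schwartz function `y ↦ ψ(x - y)`. -/
def reflectTranslate {d : ℕ} (ψ : 𝓢(E d, ℂ)) (x : E d) : 𝓢(E d, ℂ) :=
  compSubConstCLM ℂ x (compCLMOfContinuousLinearEquiv ℂ (ContinuousLinearEquiv.neg ℝ) ψ)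

theorem reflectTranslate_apply {d : ℕ} (ψ : 𝓢(E d, ℂ)) (x y : E d) :
    reflectTranslate ψ x y = ψ (x - y) :=
  congrArg ψ (neg_sub y x)

/-- The convolution `ψ * f` of a Schwartz function with a tempered distribution, which is the
function `x ↦ f(ψ(x - ·))`. -/
def conv {d : ℕ} (ψ : 𝓢(E d, ℂ)) (f : 𝓢'(E d, ℂ)) (x : E d) : ℂ :=
  f (reflectTranslate ψ x)

/-- A Littlewood-Paley resolution of unity: `φ̂` is supported in `{1/2 ≤ |ξ| ≤ 2}`,
`∑_{k ∈ ℤ} φ̂_k(ξ) = 1` for `ξ ≠ 0`, and `Φ̂ = 1 - ∑_{k ≥ 1} φ̂_k`. -/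
structure LittlewoodPaley (d : ℕ) where
  φ : 𝓢(E d, ℂ)
  Φ : 𝓢(E d, ℂ)
  support_φ : tsupport (𝓕 φ : 𝓢(E d, ℂ)) ⊆ {ξ : E d | 1 / 2 ≤ ‖ξ‖ ∧ ‖ξ‖ ≤ 2}
  sum_φ : ∀ ξ : E d, ξ ≠ 0 → HasSum (fun k : ℤ => (𝓕 (dilate k φ) : 𝓢(E d, ℂ)) ξ) 1
  fourier_Φ : ∀ ξ : E d, (𝓕 Φ : 𝓢(E d, ℂ)) ξ = 1 - ∑' k : Set.Ici (1 : ℤ),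
    (𝓕 (dilate (k : ℤ) φ) : 𝓢(E d, ℂ)) ξ

/-- `Λ_0 f = Φ * f` and `Λ_k f = φ_k * f` for `k ≥ 1`. -/
def LittlewoodPaley.Lam {d : ℕ} (L : LittlewoodPaley d) (k : ℕ) (f : 𝓢'(E d, ℂ)) : E d → ℂ :=
  if k = 0 then conv L.Φ f else conv (dilate k L.φ) f

/-- The `F_∞^{s,q}` quasi-norm with values in `[0, ∞]`, for `0 < q ≤ ∞`:
for `q = ∞` it is `‖ sup_{k ≥ 0} 2^{sk} |Λ_k f| ‖_{L^∞}`, and for `q < ∞` it is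
`‖Λ_0 f‖_{L^∞} + sup_{P dyadic, l(P) < 1}
  ( |P|⁻¹ ∫_P ∑_{k ≥ -log₂ l(P)} 2^{skq} |Λ_k f(x)|^q dx )^{1/q}`.
The dyadic cubes with `l(P) < 1` are the `dyadicCube j n` with `j ≥ 1`. -/
def LittlewoodPaley.FNorm {d : ℕ} (L : LittlewoodPaley d) (s : ℝ) (q : ℝ≥0∞)
    (f : 𝓢'(E d, ℂ)) : ℝ≥0∞ :=
  if q = ∞ then
    essSup (fun x => ⨆ k : ℕ, ENNReal.ofReal ((2 : ℝ) ^ (s * k)) * ‖L.Lam k f x‖ₑ) volume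
  else
    eLpNorm (L.Lam 0 f) ∞ volume +
      ⨆ (j : ℕ) (_ : 1 ≤ j) (n : Fin d → ℤ),
        (⨍⁻ x in dyadicCube (j : ℤ) n, ∑' k : Set.Ici j,
          ENNReal.ofReal ((2 : ℝ) ^ (s * (k : ℕ) * q.toReal)) *
            ‖L.Lam k f x‖ₑ ^ q.toReal ∂volume) ^ (1 / q.toReal)

/-- The space `F_∞^{s,q}`: the tempered distributions of finite `F_∞^{s,q}` quasi-norm. -/
def LittlewoodPaley.FSpace {d : ℕ} (L : LittlewoodPaley d) (s : ℝ) (q : ℝ≥0∞) :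
    Set 𝓢'(E d, ℂ) :=
  {f | L.FNorm s q f < ∞}

end TriebelLizorkinInfty

end

open TriebelLizorkinInfty

/-! Everything rests on one bound: a function F with frequencies of size O(2^k) is controlled
uniformly by its L^q averages over the dyadic cubes of side 2^{-k}, also for q < 1
(`exists_enorm_le_of_reproducing`). Those averages occur in V_{μ,q} as the single term k = -log₂
l(P), which gives (2). Then |f_k|^{q₂} ≤ ‖f_k‖_∞^{q₂-q₁} |f_k|^{q₁}, summed over k and averaged over
P, gives (1) (`laverage_tsum_rpow_le`). Part (3) is the same argument for 2^{sk} Λ_k f with k ≥ 1.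
The piece Λ_0 f has its own term in the norm, and for q₂ = ∞ the uniform bound already suffices.

For the key bound, F = ψ_k * F with ψ Schwartz. Put r = min(q, 1) and let S be the supremum of (1 +
2^k|y - x₀|)^{-N} |F(y)|. Writing |F| = |F|^{1-r} |F|^r under the convolution yields S ≤ L S^{1-r}
B^r, where B^r bounds the averages of |F|^r. If S is finite, then S ≤ L^{1/r} B. Polynomial growth
makes S finite for some N; this shows that F is bounded, and a second pass with N = 0 gives a
constant independent of F.

The reproducing formula needs two facts on tempered distributions: T(η * τ) = ∫ η(x) T(τ(· - x)) dx
(`apply_convolution`), and T u = 0 when the supports of u and T are disjoint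
(`apply_eq_zero_of_disjoint_dsupport`). -/

namespace SchwartzMap

open Filter Topology BoundedContinuousFunction

/-! ### Translates of a Schwartz function: growth and continuity. -/

section Translation

variable {X : Type*} [NormedAddCommGroup X] [NormedSpace ℝ X]

theorem exists_one_add_norm_pow_mul_iteratedFDeriv_le (τ : 𝓢(X, ℂ)) (k n : ℕ) :
    ∃ C : ℝ, 0 ≤ C ∧ ∀ z : X, (1 + ‖z‖) ^ k * ‖iteratedFDeriv ℝ n τ z‖ ≤ C :=
  ⟨_, by positivity, fun z => one_add_le_sup_seminorm_apply (𝕜 := ℝ) (m := (k, n)) le_rfl le_rfl τ z⟩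

theorem exists_seminorm_compSubConstCLM_le (τ : 𝓢(X, ℂ)) (k n : ℕ) :
    ∃ C : ℝ, 0 ≤ C ∧ ∀ x : X,
      SchwartzMap.seminorm ℂ k n (compSubConstCLM ℂ x τ) ≤ C * (1 + ‖x‖) ^ k := by
  obtain ⟨C, hC0, hC⟩ := exists_one_add_norm_pow_mul_iteratedFDeriv_le τ k n
  refine ⟨C, hC0, fun x => seminorm_le_bound ℂ k n _ (by positivity) fun z => ?_⟩
  have h1 : iteratedFDeriv ℝ n (compSubConstCLM ℂ x τ) z = iteratedFDeriv ℝ n τ (z - x) :=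
    iteratedFDeriv_comp_sub n x z
  have h2 : ‖z‖ ≤ (1 + ‖z - x‖) * (1 + ‖x‖) := by
    nlinarith [norm_sub_norm_le z x, norm_nonneg (z - x), norm_nonneg x]
  rw [h1]
  calc ‖z‖ ^ k * ‖iteratedFDeriv ℝ n τ (z - x)‖
      ≤ ((1 + ‖z - x‖) * (1 + ‖x‖)) ^ k * ‖iteratedFDeriv ℝ n τ (z - x)‖ := by gcongr
    _ = (1 + ‖z - x‖) ^ k * ‖iteratedFDeriv ℝ n τ (z - x)‖ * (1 + ‖x‖) ^ k := by rw [mul_pow]; ring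
    _ ≤ C * (1 + ‖x‖) ^ k := by gcongr; exact hC _

/-- Mean value inequality for D^n τ on the segment from z - y to z - x, with the weight ‖z‖^k
frozen. Along the segment ‖z‖ ≤ (1 + ‖w‖)(1 + ‖x‖ + ‖y‖), so the decay of D^{n+1} τ at w absorbs the
weight. -/
theorem exists_seminorm_compSubConstCLM_sub_le (τ : 𝓢(X, ℂ)) (k n : ℕ) :
    ∃ C : ℝ, 0 ≤ C ∧ ∀ x y : X,
      SchwartzMap.seminorm ℂ k n (compSubConstCLM ℂ x τ - compSubConstCLM ℂ y τ) ≤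
        C * (1 + ‖x‖ + ‖y‖) ^ k * ‖x - y‖ := by
  obtain ⟨C, hC0, hC⟩ := exists_one_add_norm_pow_mul_iteratedFDeriv_le τ k (n + 1)
  refine ⟨C, hC0, fun x y => seminorm_le_bound ℂ k n _ (by positivity) fun z => ?_⟩
  have h1 : iteratedFDeriv ℝ n (compSubConstCLM ℂ x τ - compSubConstCLM ℂ y τ : 𝓢(X, ℂ)) z =
      iteratedFDeriv ℝ n τ (z - x) - iteratedFDeriv ℝ n τ (z - y) := by
    have : ((compSubConstCLM ℂ x τ - compSubConstCLM ℂ y τ : 𝓢(X, ℂ)) : X → ℂ) =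
      (fun w => τ (w - x)) - (fun w => τ (w - y)) := rfl
    rw [this, iteratedFDeriv_sub_apply, iteratedFDeriv_comp_sub, iteratedFDeriv_comp_sub]
    · exact ((compSubConstCLM ℂ x τ).smooth n).contDiffAt
    · exact ((compSubConstCLM ℂ y τ).smooth n).contDiffAt
  have hd : Differentiable ℝ (iteratedFDeriv ℝ n τ) :=
    (τ.smooth (n + 1 : ℕ)).differentiable_iteratedFDeriv (by exact_mod_cast Nat.lt_succ_self n)
  have key := Convex.norm_image_sub_le_of_norm_fderiv_le (𝕜 := ℝ)
    (f := fun w => ‖z‖ ^ k • iteratedFDeriv ℝ n τ w) (s := segment ℝ (z - y) (z - x))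
    (C := C * (1 + ‖x‖ + ‖y‖) ^ k) (x := z - y) (y := z - x)
    (fun w _ => (hd w).fun_const_smul _) ?_ (convex_segment _ _) (left_mem_segment _ _ _)
    (right_mem_segment _ _ _)
  · rw [h1]
    have e : z - x - (z - y) = -(x - y) := by abel
    rw [← smul_sub, norm_smul, norm_pow, norm_norm, e, norm_neg] at key
    exact key
  · intro w hw
    rw [fderiv_fun_const_smul (hd w), norm_smul, norm_pow, norm_norm, norm_fderiv_iteratedFDeriv]
    have h2 : ‖z‖ ≤ (1 + ‖w‖) * (1 + ‖x‖ + ‖y‖) := by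
      obtain ⟨a, b, ha, hb, hab, rfl⟩ := hw
      have : z = (a • (z - y) + b • (z - x)) + (a • y + b • x) := by
        rw [smul_sub, smul_sub]
        have : z = a • z + b • z := by rw [← add_smul, hab, one_smul]
        nth_rw 1 [this]; abel
      have h3 : ‖a • y + b • x‖ ≤ ‖x‖ + ‖y‖ := by
        refine (norm_add_le _ _).trans ?_
        rw [norm_smul, norm_smul, Real.norm_of_nonneg ha, Real.norm_of_nonneg hb]
        nlinarith [norm_nonneg x, norm_nonneg y]
      have h4 := norm_add_le (a • (z - y) + b • (z - x)) (a • y + b • x)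
      rw [← this] at h4
      nlinarith [norm_nonneg (a • (z - y) + b • (z - x)), norm_nonneg x, norm_nonneg y]
    calc ‖z‖ ^ k * ‖iteratedFDeriv ℝ (n + 1) τ w‖
        ≤ ((1 + ‖w‖) * (1 + ‖x‖ + ‖y‖)) ^ k * ‖iteratedFDeriv ℝ (n + 1) τ w‖ := by gcongr
      _ = (1 + ‖w‖) ^ k * ‖iteratedFDeriv ℝ (n + 1) τ w‖ * (1 + ‖x‖ + ‖y‖) ^ k := by rw [mul_pow]; ring
      _ ≤ C * (1 + ‖x‖ + ‖y‖) ^ k := by gcongr; exact hC _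

/-- Needed for the measurability of the vector-valued integrands below and for the continuity of ψ *
T. -/
theorem continuous_compSubConstCLM (τ : 𝓢(X, ℂ)) :
    Continuous fun x : X => compSubConstCLM ℂ x τ := by
  rw [continuous_iff_continuousAt]
  intro y
  rw [ContinuousAt, (schwartz_withSeminorms ℂ X ℂ).tendsto_nhds]
  rintro ⟨k, n⟩ ε hε
  obtain ⟨C, hC0, hC⟩ := exists_seminorm_compSubConstCLM_sub_le τ k n
  have h : Tendsto (fun x : X => C * (1 + ‖x‖ + ‖y‖) ^ k * ‖x - y‖) (𝓝 y) (𝓝 0) := by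
    have : Continuous fun x : X => C * (1 + ‖x‖ + ‖y‖) ^ k * ‖x - y‖ := by fun_prop
    simpa using this.tendsto y
  filter_upwards [h.eventually_lt_const hε] with x hx using (hC x y).trans_lt hx

/-- A continuous linear functional on the Schwartz space grows at most polynomially along
translations. -/
theorem exists_norm_apply_compSubConstCLM_le (T : 𝓢(X, ℂ) →L[ℂ] ℂ) (τ : 𝓢(X, ℂ)) :
    ∃ (C : ℝ) (N : ℕ), 0 ≤ C ∧ ∀ x : X, ‖T (compSubConstCLM ℂ x τ)‖ ≤ C * (1 + ‖x‖) ^ N := by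
  obtain ⟨s, C, -, hC⟩ := Seminorm.bound_of_continuous (schwartz_withSeminorms ℂ X ℂ)
    ((normSeminorm ℂ ℂ).comp T.toLinearMap) (by exact T.continuous.norm)
  choose B hB0 hB using fun i : ℕ × ℕ => exists_seminorm_compSubConstCLM_le τ i.1 i.2
  -- A seminorm with weight exponent k grows like (1 + ‖x‖)^k along translations, so the largest k
  -- among the finitely many seminorms dominating `T` is the degree.
  refine ⟨C * ∑ i ∈ s, B i, s.sup Prod.fst, ?_, fun x => ?_⟩
  · exact mul_nonneg C.2 (Finset.sum_nonneg fun i _ => hB0 i)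
  have h1 : ‖T (compSubConstCLM ℂ x τ)‖ ≤
      C * s.sup (schwartzSeminormFamily ℂ X ℂ) (compSubConstCLM ℂ x τ) := hC _
  refine h1.trans ?_
  rw [mul_assoc]
  gcongr
  have hS : 0 ≤ ∑ i ∈ s, B i := Finset.sum_nonneg fun i _ => hB0 i
  refine Seminorm.finset_sup_apply_le (by positivity) fun i hi => (hB i x).trans ?_
  gcongr
  · exact Finset.single_le_sum (fun j _ => hB0 j) hi
  · linarith [norm_nonneg x]
  · exact Finset.le_sup (f := Prod.fst) hi

end Translation

/-! ### Schwartz seminorms as Banach space norms, and factorization of functionals. -/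

section Evaluation

variable {X : Type*} [NormedAddCommGroup X] [NormedSpace ℝ X]

/-- The bounded continuous functions with values in the `n`-linear forms, `n = i.2`. -/
def FormSpace (X : Type*) [NormedAddCommGroup X] [NormedSpace ℝ X] (i : ℕ × ℕ) : Type _ :=
  X →ᵇ ContinuousMultilinearMap ℝ (fun _ : Fin i.2 => X) ℂ

noncomputable instance (i : ℕ × ℕ) : NormedAddCommGroup (FormSpace X i) :=
  inferInstanceAs
    (NormedAddCommGroup (X →ᵇ ContinuousMultilinearMap ℝ (fun _ : Fin i.2 => X) ℂ))

noncomputable instance (i : ℕ × ℕ) : NormedSpace ℂ (FormSpace X i) :=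
  inferInstanceAs
    (NormedSpace ℂ (X →ᵇ ContinuousMultilinearMap ℝ (fun _ : Fin i.2 => X) ℂ))

instance (i : ℕ × ℕ) : CompleteSpace (FormSpace X i) :=
  inferInstanceAs
    (CompleteSpace (X →ᵇ ContinuousMultilinearMap ℝ (fun _ : Fin i.2 => X) ℂ))

/-- Evaluation of an element of `FormSpace X i` at a point and at vectors. -/
noncomputable def FormSpace.evalCLM {i : ℕ × ℕ} (z : X) (m : Fin i.2 → X) :
    FormSpace X i →L[ℂ] ℂ :=
  LinearMap.mkContinuous
    { toFun := fun u => (show X →ᵇ ContinuousMultilinearMap ℝ (fun _ : Fin i.2 => X) ℂ from u) z m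
      map_add' := fun _ _ => rfl
      map_smul' := fun _ _ => rfl } (∏ j, ‖m j‖) fun u => by
    let v : X →ᵇ ContinuousMultilinearMap ℝ (fun _ : Fin i.2 => X) ℂ := u
    change ‖v z m‖ ≤ _ * ‖v‖
    rw [mul_comm]
    exact ((v z).le_opNorm m).trans (by gcongr; exact v.norm_coe_le_norm z)

theorem FormSpace.ext_evalCLM {i : ℕ × ℕ} {u v : FormSpace X i}
    (h : ∀ z m, FormSpace.evalCLM z m u = FormSpace.evalCLM z m v) : u = v :=
  BoundedContinuousFunction.ext fun z => ContinuousMultilinearMap.ext fun m => h z m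

/-- The bounded continuous function `x ↦ ‖x‖ ^ k • D^n φ(x)`, for a Schwartz function `φ`. -/
noncomputable def weightedDeriv (i : ℕ × ℕ) (φ : 𝓢(X, ℂ)) : FormSpace X i :=
  BoundedContinuousFunction.ofNormedAddCommGroup
    (fun x => ‖x‖ ^ i.1 • iteratedFDeriv ℝ i.2 φ x)
    ((continuous_norm.pow _).smul ((φ.smooth i.2).continuous_iteratedFDeriv le_rfl))
    (SchwartzMap.seminorm ℂ i.1 i.2 φ)
    (fun x => by
      rw [norm_smul, norm_pow, norm_norm]
      exact le_seminorm ℂ _ _ φ x)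

/-- Evaluations separate the points of `FormSpace X i`, so identities there reduce to scalar
identities between iterated directional derivatives. -/
theorem evalCLM_weightedDeriv (i : ℕ × ℕ) (φ : 𝓢(X, ℂ)) (z : X) (m : Fin i.2 → X) :
    FormSpace.evalCLM z m (weightedDeriv i φ) =
      (‖z‖ ^ i.1 : ℝ) * LineDeriv.iteratedLineDerivOp m φ z := by
  rw [iteratedLineDerivOp_eq_iteratedFDeriv, ← Complex.real_smul]
  rfl

theorem norm_weightedDeriv_le (i : ℕ × ℕ) (φ : 𝓢(X, ℂ)) :
    ‖weightedDeriv i φ‖ ≤ SchwartzMap.seminorm ℂ i.1 i.2 φ :=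
  BoundedContinuousFunction.norm_ofNormedAddCommGroup_le _ (apply_nonneg _ _) _

/-- With the reverse inequality, continuity of a functional on Schwartz space becomes domination by
finitely many Banach space norms. -/
theorem seminorm_le_norm_weightedDeriv (i : ℕ × ℕ) (φ : 𝓢(X, ℂ)) :
    schwartzSeminormFamily ℂ X ℂ i φ ≤ ‖weightedDeriv i φ‖ :=
  seminorm_le_bound ℂ i.1 i.2 φ (norm_nonneg (weightedDeriv i φ)) fun x => by
    let v : X →ᵇ ContinuousMultilinearMap ℝ (fun _ : Fin i.2 => X) ℂ := weightedDeriv i φ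
    have h1 : ‖v x‖ ≤ ‖v‖ := v.norm_coe_le_norm x
    have h2 : v x = ‖x‖ ^ i.1 • iteratedFDeriv ℝ i.2 φ x := rfl
    rw [h2, norm_smul, norm_pow, norm_norm] at h1
    exact h1

/-- The map `φ ↦ ‖·‖ ^ k • D^n φ` as a continuous linear map. -/
noncomputable def weightedDerivCLM (X : Type*) [NormedAddCommGroup X] [NormedSpace ℝ X]
    (i : ℕ × ℕ) : 𝓢(X, ℂ) →L[ℂ] FormSpace X i :=
  mkCLMtoNormedSpace (σ := RingHom.id ℂ) (weightedDeriv (X := X) i)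
    (fun f g => FormSpace.ext_evalCLM fun z m => by
      rw [map_add, evalCLM_weightedDeriv, evalCLM_weightedDeriv, evalCLM_weightedDeriv,
        LineDeriv.iteratedLineDerivOp_add, _root_.add_apply, mul_add])
    (fun a f => FormSpace.ext_evalCLM fun z m => by
      rw [map_smul, evalCLM_weightedDeriv, evalCLM_weightedDeriv,
        LineDeriv.iteratedLineDerivOp_smul, _root_.smul_apply, smul_eq_mul, smul_eq_mul,
        RingHom.id_apply, mul_left_comm])
    ⟨{i}, 1, zero_le_one, fun f => by
      rw [Finset.sup_singleton, one_mul]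
      exact norm_weightedDeriv_le i f⟩

theorem weightedDerivCLM_apply (i : ℕ × ℕ) (φ : 𝓢(X, ℂ)) :
    weightedDerivCLM X i φ = weightedDeriv i φ := rfl

end Evaluation

end SchwartzMap

/-- A linear functional dominated by the norm of a linear map into a normed space factors through
a bounded functional on that space. -/
theorem LinearMap.exists_strongDual_comp_eq {V Y : Type*} [AddCommGroup V] [Module ℂ V]
    [NormedAddCommGroup Y] [NormedSpace ℂ Y] (T : V →ₗ[ℂ] ℂ) (J : V →ₗ[ℂ] Y) (C : ℝ)
    (h : ∀ v, ‖T v‖ ≤ C * ‖J v‖) : ∃ g : StrongDual ℂ Y, ∀ v, g (J v) = T v := by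
  -- The bound makes `T` constant on the fibres of `J`. It therefore descends to a bounded
  -- functional on the range, which Hahn–Banach extends.
  have hwd : ∀ v w, J v = J w → T v = T w := fun v w hvw => by
    have := h (v - w)
    rw [map_sub, map_sub, hvw, sub_self, norm_zero, mul_zero] at this
    exact sub_eq_zero.1 (norm_le_zero_iff.1 this)
  choose c hc using fun y : LinearMap.range J => y.2
  let f : LinearMap.range J →ₗ[ℂ] ℂ :=
    { toFun := fun y => T (c y)
      map_add' := fun y z => by
        rw [← map_add]; exact hwd _ _ (by rw [map_add, hc, hc, hc]; rfl)
      map_smul' := fun a y => by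
        rw [RingHom.id_apply, ← map_smul]; exact hwd _ _ (by rw [map_smul, hc, hc]; rfl) }
  obtain ⟨g, hg, -⟩ := exists_extension_norm_eq (LinearMap.range J)
    (f.mkContinuous C fun y => by
      have := h (c y)
      rwa [hc] at this)
  refine ⟨g, fun v => ?_⟩
  have := hg ⟨J v, LinearMap.mem_range_self J v⟩
  exact this.trans (hwd _ _ (hc _))

/-- A linear functional dominated by finitely many linear maps into normed spaces is a sum of
bounded functionals applied to these maps. -/
theorem LinearMap.exists_strongDual_sum_eq {V ι : Type*} [Fintype ι] {Z : ι → Type*}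
    [AddCommGroup V] [Module ℂ V] [∀ i, NormedAddCommGroup (Z i)] [∀ i, NormedSpace ℂ (Z i)]
    (T : V →ₗ[ℂ] ℂ) (J : ∀ i, V →ₗ[ℂ] Z i) (C : ℝ)
    (h : ∀ v a, 0 ≤ a → (∀ i, ‖J i v‖ ≤ a) → ‖T v‖ ≤ C * a) :
    ∃ g : ∀ i, StrongDual ℂ (Z i), ∀ v, T v = ∑ i, g i (J i v) := by
  classical
  -- The product carries the sup norm; restricting the functional to the coordinate axes gives the
  -- summands.
  obtain ⟨g, hg⟩ := T.exists_strongDual_comp_eq (LinearMap.pi J) C fun v =>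
    h v _ (norm_nonneg _) fun i => norm_le_pi_norm (LinearMap.pi J v) i
  refine ⟨fun i => g ∘L ContinuousLinearMap.single ℂ Z i, fun v => ?_⟩
  rw [← hg]
  simp only [ContinuousLinearMap.comp_apply, ← map_sum]
  congr 1
  exact (Finset.univ_sum_single (LinearMap.pi J v)).symm

namespace SchwartzMap

open Filter Topology BoundedContinuousFunction

/-! ### Applying a distribution under a convolution integral. -/

section Convolution

variable {X : Type*} [NormedAddCommGroup X] [InnerProductSpace ℝ X] [FiniteDimensional ℝ X]
  [MeasurableSpace X] [BorelSpace X]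

theorem integrable_smul_of_norm_le_pow {Y : Type*} [NormedAddCommGroup Y] [NormedSpace ℂ Y]
    (η : 𝓢(X, ℂ)) {G : X → Y} (hG : Continuous G) {C : ℝ} {N : ℕ}
    (h : ∀ x, ‖G x‖ ≤ C * (1 + ‖x‖) ^ N) : Integrable fun x => η x • G x := by
  have h1 : Integrable fun x => |C| * (2 ^ (N - 1) * (‖x‖ ^ 0 * ‖η x‖ + ‖x‖ ^ N * ‖η x‖)) :=
    (((η.integrable_pow_mul volume 0).add (η.integrable_pow_mul volume N)).const_mul _).const_mul _
  refine h1.mono' (η.continuous.smul hG).aestronglyMeasurable (ae_of_all _ fun x => ?_)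
  rw [norm_smul]
  have h2 : (1 + ‖x‖) ^ N ≤ 2 ^ (N - 1) * (1 ^ N + ‖x‖ ^ N) :=
    add_pow_le zero_le_one (norm_nonneg _) _
  rw [one_pow] at h2
  calc ‖η x‖ * ‖G x‖ ≤ ‖η x‖ * (|C| * (2 ^ (N - 1) * (1 + ‖x‖ ^ N))) := by
        gcongr
        refine (h x).trans ?_
        gcongr
        exact le_abs_self C
    _ = _ := by ring

theorem eq_of_fourier_eq {f g : 𝓢(X, ℂ)} (h : 𝓕 f = 𝓕 g) : f = g := by
  rw [← FourierTransform.fourierInv_fourier_eq (F := 𝓢(X, ℂ)) f, h,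
    FourierTransform.fourierInv_fourier_eq]

/-- On the Fourier side a derivative is a multiplier and a convolution is a product, so no
differentiation under the integral is needed. -/
theorem lineDerivOp_convolution (η τ : 𝓢(X, ℂ)) (v : X) :
    LineDeriv.lineDerivOp v (convolution (ContinuousLinearMap.mul ℂ ℂ) η τ) =
      convolution (ContinuousLinearMap.mul ℂ ℂ) η (LineDeriv.lineDerivOp v τ) := by
  refine eq_of_fourier_eq ?_
  have hv : (fun x : X => inner ℝ x v).HasTemperateGrowth := by fun_prop
  rw [fourier_convolution, fourier_lineDerivOp_eq, fourier_lineDerivOp_eq, fourier_convolution]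
  ext ξ
  simp only [_root_.smul_apply, smulLeftCLM_apply_apply hv, pairing_apply_apply,
    ContinuousLinearMap.mul_apply', smul_eq_mul, Complex.real_smul]
  ring

theorem iteratedLineDerivOp_convolution (η τ : 𝓢(X, ℂ)) {n : ℕ} (m : Fin n → X) :
    LineDeriv.iteratedLineDerivOp m (convolution (ContinuousLinearMap.mul ℂ ℂ) η τ) =
      convolution (ContinuousLinearMap.mul ℂ ℂ) η (LineDeriv.iteratedLineDerivOp m τ) := by
  induction n with
  | zero => simp
  | succ n ih =>
    rw [LineDeriv.iteratedLineDerivOp_succ_left, ih, lineDerivOp_convolution,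
      ← LineDeriv.iteratedLineDerivOp_succ_left]

theorem convolution_mul_apply (η τ : 𝓢(X, ℂ)) (z : X) :
    convolution (ContinuousLinearMap.mul ℂ ℂ) η τ z = ∫ x, η x * τ (z - x) := by
  rw [convolution_apply]; rfl

theorem integrable_smul_weightedDerivCLM (i : ℕ × ℕ) (η τ : 𝓢(X, ℂ)) :
    Integrable fun x => η x • weightedDerivCLM X i (compSubConstCLM ℂ x τ) := by
  obtain ⟨B, hB0, hB⟩ := exists_seminorm_compSubConstCLM_le τ i.1 i.2
  exact integrable_smul_of_norm_le_pow η
    ((weightedDerivCLM X i).continuous.comp (continuous_compSubConstCLM τ))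
    fun x => (norm_weightedDeriv_le i (compSubConstCLM ℂ x τ)).trans (hB x)

/-- Evaluated at a point and at directions, the Bochner integral is a scalar convolution of η with a
derivative of τ, up to the weight. -/
theorem integral_smul_weightedDerivCLM (i : ℕ × ℕ) (η τ : 𝓢(X, ℂ)) :
    ∫ x, η x • weightedDerivCLM X i (compSubConstCLM ℂ x τ) =
      weightedDerivCLM X i (convolution (ContinuousLinearMap.mul ℂ ℂ) η τ) := by
  refine FormSpace.ext_evalCLM fun z m => ?_
  rw [← ContinuousLinearMap.integral_comp_comm _ (integrable_smul_weightedDerivCLM i η τ),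
    weightedDerivCLM_apply, evalCLM_weightedDeriv,
    iteratedLineDerivOp_convolution, convolution_mul_apply, ← integral_const_mul]
  refine integral_congr_ae (ae_of_all _ fun x => ?_)
  have h1 : LineDeriv.iteratedLineDerivOp m (compSubConstCLM ℂ x τ) z =
      LineDeriv.iteratedLineDerivOp m τ (z - x) := by
    rw [iteratedLineDerivOp_eq_iteratedFDeriv, iteratedLineDerivOp_eq_iteratedFDeriv]
    exact congrArg (· m) (iteratedFDeriv_comp_sub (𝕜 := ℝ) (f := τ) _ x z)
  simp only [map_smul, weightedDerivCLM_apply, evalCLM_weightedDeriv, h1, smul_eq_mul]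
  ring

/-- A continuous linear functional on the Schwartz space can be applied under the integral sign of
a convolution. -/
theorem apply_convolution (T : 𝓢(X, ℂ) →L[ℂ] ℂ) (η τ : 𝓢(X, ℂ)) :
    T (convolution (ContinuousLinearMap.mul ℂ ℂ) η τ) =
      ∫ x, η x * T (compSubConstCLM ℂ x τ) := by
  obtain ⟨s, C, -, hC⟩ := Seminorm.bound_of_continuous (schwartz_withSeminorms ℂ X ℂ)
    ((normSeminorm ℂ ℂ).comp T.toLinearMap) (by exact T.continuous.norm)
  -- Schwartz space is not normed, so `T` is written as a finite sum of bounded functionals on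
  -- Banach spaces, each of which commutes with the Bochner integral.
  obtain ⟨g, hg⟩ := T.toLinearMap.exists_strongDual_sum_eq
    (fun i : s => (weightedDerivCLM X i.1).toLinearMap) C fun v a ha hv => by
      have h1 : ‖T v‖ ≤ (C : ℝ) * s.sup (schwartzSeminormFamily ℂ X ℂ) v := hC v
      refine h1.trans ?_
      gcongr
      exact Seminorm.finset_sup_apply_le ha fun i hi =>
        (seminorm_le_norm_weightedDeriv i v).trans (hv ⟨i, hi⟩)
  replace hg : ∀ v, T v = ∑ i, g i (weightedDerivCLM X i.1 v) := hg
  have hint := fun i : s => integrable_smul_weightedDerivCLM i.1 η τ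
  rw [hg]
  calc ∑ i, g i (weightedDerivCLM X i.1 (convolution (ContinuousLinearMap.mul ℂ ℂ) η τ))
      = ∑ i, ∫ x, g i (η x • weightedDerivCLM X i.1 (compSubConstCLM ℂ x τ)) := by
        refine Finset.sum_congr rfl fun i _ => ?_
        rw [← integral_smul_weightedDerivCLM, (g i).integral_comp_comm (hint i)]
    _ = ∫ x, ∑ i, g i (η x • weightedDerivCLM X i.1 (compSubConstCLM ℂ x τ)) :=
        (integral_finsetSum _ fun i _ => (g i).integrable_comp (hint i)).symm
    _ = _ := by
        refine integral_congr_ae (ae_of_all _ fun x => ?_)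
        simp only [hg, Finset.mul_sum, map_smul, smul_eq_mul]

end Convolution

end SchwartzMap

namespace SchwartzMap

open Filter Topology Distribution

/-! ### Distributions and test functions with disjoint supports. -/

section Support

variable {X : Type*} [NormedAddCommGroup X] [NormedSpace ℝ X]

open scoped ContDiff Manifold

/-- The product of a smooth real function and a compactly supported Schwartz function. -/
theorem exists_eq_ofReal_mul {ρ : X → ℝ} (hρ : ContDiff ℝ ∞ ρ) {u : 𝓢(X, ℂ)}
    (hu : HasCompactSupport u) : ∃ v : 𝓢(X, ℂ), ∀ x, v x = (ρ x : ℂ) * u x :=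
  have hc : HasCompactSupport fun x => (ρ x : ℂ) * u x := hu.mul_left
  ⟨hc.toSchwartzMap ((Complex.ofRealCLM.contDiff.comp hρ).mul (u.smooth ⊤)), fun _ => rfl⟩

variable [FiniteDimensional ℝ X]

/-- A finite smooth partition of unity subordinate to an open cover of a closed set. -/
theorem exists_contDiff_partition {ι : Type*} [Fintype ι] {K : Set X} (hK : IsClosed K)
    (U : ι → Set X) (hUo : ∀ i, IsOpen (U i)) (hKU : K ⊆ ⋃ i, U i) :
    ∃ ρ : ι → X → ℝ, (∀ i, ContDiff ℝ ∞ (ρ i)) ∧ (∀ i, tsupport (ρ i) ⊆ U i) ∧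
      ∀ x ∈ K, ∑ i, ρ i x = 1 := by
  obtain ⟨ρ, hρ⟩ := SmoothPartitionOfUnity.exists_isSubordinate 𝓘(ℝ, X) hK U hUo hKU
  refine ⟨fun i => ρ i, fun i => (ρ i).contMDiff.contDiff, hρ, fun x hx => ?_⟩
  rw [← ρ.sum_eq_one hx, finsum_eq_sum_of_fintype]

/-- A tempered distribution vanishes on compactly supported test functions supported away from its
support. -/
theorem apply_eq_zero_of_hasCompactSupport (T : 𝓢(X, ℂ) →L[ℂ] ℂ) (u : 𝓢(X, ℂ))
    (hu : HasCompactSupport u) (h : Disjoint (tsupport u) (dsupport T)) : T u = 0 := by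
  -- Vanishing is known only locally; compactness and a finite partition of unity split `u` into
  -- pieces that each live in one vanishing set.
  have hloc : ∀ x ∈ tsupport u, ∃ s : Set X, IsVanishingOn T s ∧ IsOpen s ∧ x ∈ s := fun x hx =>
    (notMem_dsupport_iff x).1 (Set.disjoint_left.1 h hx)
  choose U hU hUo hxU using hloc
  obtain ⟨t, htU⟩ := hu.elim_nhds_subcover' U
    (fun x hx => (hUo x hx).mem_nhds (hxU x hx))
  obtain ⟨ρ, hρ, hρU, hρ1⟩ := exists_contDiff_partition (K := tsupport u)
    (isClosed_tsupport _) (fun i : t => U i.1.1 i.1.2) (fun i => hUo _ i.1.2)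
    (by
      intro x hx
      obtain ⟨y, hy, hxy⟩ := Set.mem_iUnion₂.1 (htU hx)
      exact Set.mem_iUnion.2 ⟨⟨y, hy⟩, hxy⟩)
  choose v hv using fun i => exists_eq_ofReal_mul (hρ i) hu
  have hsum : u = ∑ i, v i := by
    ext x
    rw [_root_.sum_apply]
    simp only [hv, ← Finset.sum_mul]
    by_cases hx : x ∈ tsupport u
    · rw [← Complex.ofReal_sum, hρ1 x hx, Complex.ofReal_one, one_mul]
    · rw [image_eq_zero_of_notMem_tsupport hx, mul_zero]
  rw [hsum, map_sum]
  refine Finset.sum_eq_zero fun i _ => hU i.1.1 i.1.2 _ (Set.Subset.trans ?_ (hρU i))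
  refine closure_mono fun x hx h0 => hx ?_
  rw [hv, h0, Complex.ofReal_zero, zero_mul]

/-- Compactly supported truncations of a Schwartz function converge to it. -/
theorem exists_tendsto_hasCompactSupport (u : 𝓢(X, ℂ)) :
    ∃ v : ℕ → 𝓢(X, ℂ), (∀ N, HasCompactSupport (v N)) ∧ (∀ N, tsupport (v N) ⊆ tsupport u) ∧
      Tendsto v atTop (𝓝 u) := by
  let b : ContDiffBump (0 : X) := ⟨1, 2, one_pos, one_lt_two⟩
  let χ : X → ℂ := fun x => (b x : ℂ)
  have hχ : ContDiff ℝ ∞ χ := Complex.ofRealCLM.contDiff.comp b.contDiff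
  have hχc : HasCompactSupport χ := b.hasCompactSupport.comp_left Complex.ofReal_zero
  let c : ℕ → ℝ := fun N => ((N : ℝ) + 1)⁻¹
  have hc0 : ∀ N, 0 < c N := fun N => by positivity
  have hc1 : ∀ N, c N ≤ 1 := fun N => inv_le_one_of_one_le₀ (by linarith [N.cast_nonneg (α := ℝ)])
  have hsc : ∀ N, ContDiff ℝ ∞ fun x => χ (c N • x) := fun N =>
    hχ.comp (contDiff_const_smul _)
  have hcs : ∀ N, HasCompactSupport fun x => χ (c N • x) * u x := fun N =>
    (hχc.comp_smul (hc0 N).ne').mul_right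
  have hsm : ∀ N, ContDiff ℝ ∞ fun x => χ (c N • x) * u x := fun N => (hsc N).mul (u.smooth ⊤)
  refine ⟨fun N => (hcs N).toSchwartzMap (hsm N), hcs, fun N => tsupport_mul_subset_right, ?_⟩
  rw [(schwartz_withSeminorms ℂ X ℂ).tendsto_nhds]
  rintro ⟨k, n⟩ ε hε
  -- Uniform in N because c N ≤ 1; the summand 1 in the bound accounts for the constant function.
  have hB : ∀ i, ∃ B, 0 ≤ B ∧ ∀ N x, ‖iteratedFDeriv ℝ i (fun x => χ (c N • x) - 1) x‖ ≤ B := by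
    intro i
    obtain ⟨D, hD⟩ := (hχc.toSchwartzMap hχ).decay 0 i
    have hD0 : 0 ≤ D := hD.1.le
    refine ⟨D + 1, by linarith, fun N x => ?_⟩
    have h1 : iteratedFDeriv ℝ i (fun x => χ (c N • x) - 1) x =
        c N ^ i • iteratedFDeriv ℝ i χ (c N • x) - iteratedFDeriv ℝ i (fun _ => (1 : ℂ)) x := by
      have : (fun x => χ (c N • x) - 1) = (fun x => χ (c N • x)) - (fun _ => (1 : ℂ)) := rfl
      rw [this, iteratedFDeriv_sub_apply ((hsc N).of_le (by exact_mod_cast le_top)).contDiffAt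
        contDiff_const.contDiffAt,
        iteratedFDeriv_comp_const_smul _ (hχ.of_le (by exact_mod_cast le_top))]
    have h2 : ‖iteratedFDeriv ℝ i χ (c N • x)‖ ≤ D := by
      have h := hD.2 (c N • x)
      rwa [pow_zero, one_mul] at h
    have h3 : ‖iteratedFDeriv ℝ i (fun _ : X => (1 : ℂ)) x‖ ≤ 1 := by
      rcases Nat.eq_zero_or_pos i with rfl | hi
      · simp
      · rw [iteratedFDeriv_const_of_ne hi.ne']; simp
    rw [h1]
    refine (norm_sub_le _ _).trans (add_le_add ?_ h3)
    rw [norm_smul, norm_pow, Real.norm_of_nonneg (hc0 N).le]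
    calc c N ^ i * ‖iteratedFDeriv ℝ i χ (c N • x)‖ ≤ 1 * D := by
          gcongr
          exact pow_le_one₀ (hc0 N).le (hc1 N)
      _ = D := one_mul D
  choose B hB0 hB using hB
  -- The error vanishes where ‖c N • x‖ < 1. Elsewhere 1 ≤ c N * ‖x‖, so one extra power of ‖x‖ buys
  -- a factor c N; hence the seminorms with weight exponent k + 1.
  let S : ℝ := ∑ i ∈ Finset.range (n + 1), (n.choose i : ℝ) * B i *
    SchwartzMap.seminorm ℂ (k + 1) (n - i) u
  have hS : 0 ≤ S := Finset.sum_nonneg fun i _ => by have := hB0 i; positivity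
  have key : ∀ N, SchwartzMap.seminorm ℂ k n ((hcs N).toSchwartzMap (hsm N) - u) ≤ c N * S := by
    intro N
    refine seminorm_le_bound ℂ k n _ (mul_nonneg (hc0 N).le hS) fun x => ?_
    have hfun : (((hcs N).toSchwartzMap (hsm N) - u : 𝓢(X, ℂ)) : X → ℂ) =
        fun x => (χ (c N • x) - 1) * u x := by
      funext x
      change χ (c N • x) * u x - u x = _
      ring
    rw [hfun]
    by_cases hx : ‖c N • x‖ < 1
    · have hev : (fun x => (χ (c N • x) - 1) * u x) =ᶠ[𝓝 x] fun _ => 0 := by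
        have hcont : Continuous fun x : X => ‖c N • x‖ := by fun_prop
        filter_upwards [hcont.continuousAt.eventually_lt_const hx] with y hy
        have : b (c N • y) = 1 := b.one_of_mem_closedBall (by simpa [b] using hy.le)
        simp [χ, this]
      rw [(hev.iteratedFDeriv ℝ n).eq_of_nhds]
      have h0 : iteratedFDeriv ℝ n (fun _ : X => (0 : ℂ)) x = 0 := by
        have := iteratedFDeriv_fun_zero (𝕜 := ℝ) (E := X) (F := ℂ) (n := n)
        exact congrFun this x
      rw [h0, norm_zero, mul_zero]
      exact mul_nonneg (hc0 N).le hS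
    · have hx1 : 1 ≤ c N * ‖x‖ := by
        rw [norm_smul, Real.norm_of_nonneg (hc0 N).le] at hx
        exact not_lt.1 hx
      have hl := norm_iteratedFDeriv_mul_le (𝕜 := ℝ) (f := fun x => χ (c N • x) - 1) (g := u)
        (N := n) (((hsc N).sub contDiff_const).of_le (by exact_mod_cast le_top)) (u.smooth n) x
        le_rfl
      calc ‖x‖ ^ k * ‖iteratedFDeriv ℝ n (fun x => (χ (c N • x) - 1) * u x) x‖
          ≤ (c N * ‖x‖ ^ (k + 1)) * ∑ i ∈ Finset.range (n + 1), (n.choose i : ℝ) *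
            ‖iteratedFDeriv ℝ i (fun x => χ (c N • x) - 1) x‖ *
              ‖iteratedFDeriv ℝ (n - i) u x‖ := by
            gcongr
            rw [pow_succ, ← mul_assoc, mul_comm (c N), mul_assoc]
            exact le_mul_of_one_le_right (by positivity) hx1
        _ ≤ c N * S := by
            rw [mul_assoc, Finset.mul_sum]
            refine mul_le_mul_of_nonneg_left (Finset.sum_le_sum fun i _ => ?_) (hc0 N).le
            have h1 := le_seminorm ℂ (k + 1) (n - i) u x
            calc _ = (n.choose i : ℝ) * ‖iteratedFDeriv ℝ i (fun x => χ (c N • x) - 1) x‖ *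
                  (‖x‖ ^ (k + 1) * ‖iteratedFDeriv ℝ (n - i) u x‖) := by ring
              _ ≤ _ := by
                have h2 := hB i N x
                have h3 := hB0 i
                gcongr
  have hlim : Tendsto (fun N => c N * S) atTop (𝓝 0) := by
    have : Tendsto c atTop (𝓝 0) := by
      simpa only [c, one_div] using tendsto_one_div_add_atTop_nhds_zero_nat (𝕜 := ℝ)
    simpa using this.mul_const S
  filter_upwards [hlim.eventually_lt_const hε] with N hN using (key N).trans_lt hN

/-- A tempered distribution vanishes on test functions supported away from its support. -/
theorem apply_eq_zero_of_disjoint_dsupport (T : 𝓢(X, ℂ) →L[ℂ] ℂ) (u : 𝓢(X, ℂ))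
    (h : Disjoint (tsupport u) (dsupport T)) : T u = 0 := by
  obtain ⟨v, hvc, hvs, hv⟩ := exists_tendsto_hasCompactSupport u
  refine tendsto_nhds_unique ((T.continuous.tendsto u).comp hv) ?_
  refine tendsto_const_nhds.congr fun N => ?_
  exact (apply_eq_zero_of_hasCompactSupport T (v N) (hvc N) (h.mono_left (hvs N))).symm

end Support

end SchwartzMap

namespace TriebelLizorkinInfty

open Filter Topology

/-! ### Dyadic cubes and integrable kernels at scale 2^{-k}. -/

section Cubes

variable {d : ℕ}

theorem measurableSet_dyadicCube (k : ℤ) (n : Fin d → ℤ) : MeasurableSet (dyadicCube k n) := by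
  have : dyadicCube k n = ⋂ i, ({x : E d | (2 : ℝ) ^ (-k) * (n i : ℝ) ≤ x i} ∩
      {x : E d | x i < (2 : ℝ) ^ (-k) * ((n i : ℝ) + 1)}) := by
    ext x; simp [dyadicCube]
  rw [this]
  refine MeasurableSet.iInter fun i => ?_
  have hc : Continuous fun x : E d => x i := by fun_prop
  exact (measurableSet_le measurable_const hc.measurable).inter
    (measurableSet_lt hc.measurable measurable_const)

theorem mem_dyadicCube_iff {k : ℤ} {n : Fin d → ℤ} {x : E d} :
    x ∈ dyadicCube k n ↔ ∀ i, n i = ⌊(2 : ℝ) ^ k * x i⌋ := by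
  refine forall_congr' fun i => ?_
  have h : (0 : ℝ) < 2 ^ k := by positivity
  rw [eq_comm, Int.floor_eq_iff, zpow_neg, inv_mul_le_iff₀ h, lt_inv_mul_iff₀ h]

theorem iUnion_dyadicCube (k : ℤ) : ⋃ n : Fin d → ℤ, dyadicCube (d := d) k n = Set.univ :=
  Set.eq_univ_of_forall fun x => Set.mem_iUnion.2
    ⟨fun i => ⌊(2 : ℝ) ^ k * x i⌋, mem_dyadicCube_iff.2 fun _ => rfl⟩

theorem pairwise_disjoint_dyadicCube (k : ℤ) :
    Pairwise (Function.onFun Disjoint fun n : Fin d → ℤ => dyadicCube (d := d) k n) := by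
  intro n m hnm
  refine Set.disjoint_left.2 fun x hx hy => hnm (funext fun i => ?_)
  rw [mem_dyadicCube_iff.1 hx i, mem_dyadicCube_iff.1 hy i]

theorem norm_sub_le_of_mem_dyadicCube {k : ℤ} {n : Fin d → ℤ} {x y : E d}
    (hx : x ∈ dyadicCube k n) (hy : y ∈ dyadicCube k n) : 2 ^ k * ‖x - y‖ ≤ √d := by
  have h0 : (0 : ℝ) < 2 ^ k := by positivity
  rw [← abs_of_pos h0, ← Real.norm_eq_abs, ← norm_smul, EuclideanSpace.norm_eq]
  refine Real.sqrt_le_sqrt ?_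
  calc ∑ i, ‖((2 : ℝ) ^ k • (x - y)) i‖ ^ 2 ≤ ∑ _i : Fin d, (1 : ℝ) := by
        refine Finset.sum_le_sum fun i _ => ?_
        have h1 := mem_dyadicCube_iff.1 hx i
        have h2 := mem_dyadicCube_iff.1 hy i
        have h3 : |(2 : ℝ) ^ k * x i - 2 ^ k * y i| < 1 :=
          Int.abs_sub_lt_one_of_floor_eq_floor (h1.symm.trans h2)
        have h4 : ((2 : ℝ) ^ k • (x - y)) i = 2 ^ k * x i - 2 ^ k * y i := by
          simp [mul_sub]
        rw [h4, Real.norm_eq_abs]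
        exact pow_le_one₀ (abs_nonneg _) h3.le
    _ = d := by simp

theorem volume_dyadicCube_ne_zero (k : ℤ) (n : Fin d → ℤ) :
    volume (dyadicCube (d := d) k n) ≠ 0 := by
  let c : E d := WithLp.toLp 2 fun i => (2 : ℝ) ^ (-k) * (n i + 1 / 2)
  have h0 : (0 : ℝ) < 2 ^ (-k) := by positivity
  have hsub : Metric.ball c (2 ^ (-k) / 2) ⊆ dyadicCube k n := by
    intro x hx i
    have h1 : |x i - c i| < 2 ^ (-k) / 2 :=
      (PiLp.norm_apply_le (x - c) i).trans_lt (by rwa [← dist_eq_norm])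
    have h2 : c i = (2 : ℝ) ^ (-k) * (n i + 1 / 2) := rfl
    rw [h2, abs_lt] at h1
    constructor <;> nlinarith [h1.1, h1.2]
  exact fun h => (Metric.measure_ball_pos volume c (by positivity)).ne'
    (measure_mono_null hsub h)

theorem volume_dyadicCube_ne_top (k : ℤ) (n : Fin d → ℤ) :
    volume (dyadicCube (d := d) k n) ≠ ∞ := by
  have h0 : (0 : ℝ) < 2 ^ k := by positivity
  refine (Bornology.IsBounded.measure_lt_top (Metric.isBounded_iff.2 ⟨√d / 2 ^ k, ?_⟩)).ne
  intro x hx y hy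
  rw [dist_eq_norm, le_div_iff₀ h0, mul_comm]
  exact norm_sub_le_of_mem_dyadicCube hx hy

/-- A weight that is essentially constant on the dyadic cubes of a fixed side length integrates a
function to at most its integral times the supremum of the averages of that function. -/
theorem lintegral_mul_le_iSup_laverage (k : ℤ) {g h : E d → ℝ≥0∞} (hh : Measurable h)
    (c : ℝ≥0∞) (hc : ∀ n, ∀ y ∈ dyadicCube k n, ∀ z ∈ dyadicCube k n, g y ≤ c * g z)
    (hg : Measurable g) :
    ∫⁻ y, g y * h y ≤ c * (∫⁻ y, g y) * ⨆ n, ⨍⁻ y in dyadicCube k n, h y ∂volume := by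
  have hsplit : ∀ f : E d → ℝ≥0∞, ∫⁻ y, f y = ∑' n, ∫⁻ y in dyadicCube k n, f y := fun f => by
    rw [← lintegral_iUnion (measurableSet_dyadicCube k) (pairwise_disjoint_dyadicCube k),
      iUnion_dyadicCube, setLIntegral_univ]
  rw [hsplit, hsplit g, mul_assoc, ← ENNReal.tsum_mul_right, ← ENNReal.tsum_mul_left]
  refine ENNReal.tsum_le_tsum fun n => ?_
  have hQ := measurableSet_dyadicCube k n
  have hQ0 := volume_dyadicCube_ne_zero k n
  have hQt := volume_dyadicCube_ne_top k n
  -- On each cube the weight is replaced by its own average, which decouples it from `h`.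
  have h1 : ∀ y ∈ dyadicCube k n, g y ≤ c * ⨍⁻ z in dyadicCube k n, g z ∂volume := fun y hy => by
    have : ⨍⁻ _ in dyadicCube k n, g y ∂volume ≤ ⨍⁻ z in dyadicCube k n, c * g z ∂volume := by
      rw [setLAverage_eq, setLAverage_eq]
      exact ENNReal.div_le_div_right (setLIntegral_mono' hQ fun z hz => hc n y hy z hz) _
    rw [setLAverage_const hQ0 hQt] at this
    refine this.trans_eq ?_
    rw [setLAverage_eq, setLAverage_eq, lintegral_const_mul c hg, mul_div_assoc]
  calc ∫⁻ y in dyadicCube k n, g y * h y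
      ≤ ∫⁻ y in dyadicCube k n, (c * ⨍⁻ z in dyadicCube k n, g z ∂volume) * h y :=
        setLIntegral_mono' hQ fun y hy => by gcongr; exact h1 y hy
    _ = c * ((volume (dyadicCube k n) * ⨍⁻ z in dyadicCube k n, g z ∂volume) *
          ⨍⁻ y in dyadicCube k n, h y ∂volume) := by
        rw [lintegral_const_mul _ hh, ← measure_mul_setLAverage h hQt]
        ring
    _ ≤ c * ((∫⁻ y in dyadicCube k n, g y) * ⨆ n, ⨍⁻ y in dyadicCube k n, h y ∂volume) := by
        rw [measure_mul_setLAverage g hQt]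
        gcongr
        exact le_iSup (fun n => ⨍⁻ y in dyadicCube k n, h y ∂volume) n

/-- The normalized dilates of an integrable radially decreasing function. -/
noncomputable def decayKernel (d : ℕ) (k : ℤ) (x : E d) : ℝ :=
  2 ^ (k * (d : ℤ)) * ((1 + 2 ^ k * ‖x‖) ^ (d + 1))⁻¹

theorem continuous_decayKernel (k : ℤ) : Continuous (decayKernel d k) := by
  have h0 : (0 : ℝ) < 2 ^ k := by positivity
  unfold decayKernel
  refine continuous_const.mul (Continuous.inv₀ (by fun_prop) fun x => ?_)
  positivity

/-- A cube of side 2^{-k} has diameter at most √d 2^{-k}, so 1 + 2^k ‖x - ·‖ varies on it by a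
factor of at most 1 + √d. -/
theorem decayKernel_le {k : ℤ} {n : Fin d → ℤ} {y z : E d} (x : E d) (hy : y ∈ dyadicCube k n)
    (hz : z ∈ dyadicCube k n) :
    decayKernel d k (x - y) ≤ (1 + √d) ^ (d + 1) * decayKernel d k (x - z) := by
  have h0 : (0 : ℝ) < 2 ^ k := by positivity
  have h1 : 1 + 2 ^ k * ‖x - z‖ ≤ (1 + √d) * (1 + 2 ^ k * ‖x - y‖) := by
    have h2 := norm_sub_le_of_mem_dyadicCube hy hz
    have h3 : ‖x - z‖ ≤ ‖x - y‖ + ‖y - z‖ := norm_sub_le_norm_sub_add_norm_sub x y z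
    nlinarith [mul_le_mul_of_nonneg_left h3 h0.le, Real.sqrt_nonneg d,
      mul_nonneg h0.le (norm_nonneg (x - y)), mul_nonneg (Real.sqrt_nonneg d)
        (mul_nonneg h0.le (norm_nonneg (x - y)))]
  unfold decayKernel
  rw [mul_left_comm]
  gcongr
  rw [inv_le_iff_one_le_mul₀ (by positivity), mul_right_comm, ← div_eq_mul_inv,
    le_div_iff₀ (by positivity), one_mul, ← mul_pow]
  gcongr

/-- Scaling and translation invariance; the exponent d + 1 > d gives finiteness. Independence of k
keeps the later constants uniform in the scale. -/
theorem exists_lintegral_decayKernel_eq (d : ℕ) :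
    ∃ I : ℝ≥0, ∀ (k : ℤ) (x : E d), ∫⁻ y, ENNReal.ofReal (decayKernel d k (x - y)) = I := by
  let w : E d → ℝ≥0∞ := fun z => ENNReal.ofReal (((1 + ‖z‖) ^ (d + 1))⁻¹)
  have hw : Measurable w := by
    refine ENNReal.measurable_ofReal.comp (Continuous.measurable ?_)
    refine Continuous.inv₀ (by fun_prop) fun x => ?_
    positivity
  have hfin : ∫⁻ z, w z ≠ ∞ := by
    have := finite_integral_one_add_norm (E := E d) (μ := volume) (r := (d + 1 : ℕ)) (by simp)
    refine (lt_of_eq_of_lt (lintegral_congr fun z => ?_) this).ne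
    rw [Real.rpow_neg (by positivity), Real.rpow_natCast]
  refine ⟨(∫⁻ z, w z).toNNReal, fun k x => ?_⟩
  have h0 : (0 : ℝ) < 2 ^ k := by positivity
  rw [ENNReal.coe_toNNReal hfin,
    lintegral_sub_left_eq_self (fun y => ENNReal.ofReal (decayKernel d k y)) x]
  have h1 : ∀ y : E d, ENNReal.ofReal (decayKernel d k y) =
      ENNReal.ofReal (2 ^ (k * (d : ℤ))) * w ((2 : ℝ) ^ k • y) := fun y => by
    simp only [w, decayKernel]
    rw [ENNReal.ofReal_mul (by positivity), norm_smul, Real.norm_of_nonneg h0.le]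
  simp_rw [h1]
  have h3 : Measurable fun y : E d => w ((2 : ℝ) ^ k • y) := hw.comp (measurable_const_smul _)
  rw [lintegral_const_mul _ h3,
    ← lintegral_map hw (measurable_const_smul _), Measure.map_addHaar_smul _ h0.ne',
    lintegral_smul_measure, smul_eq_mul, ← mul_assoc, ← ENNReal.ofReal_mul (by positivity)]
  have h2 : (2 : ℝ) ^ (k * (d : ℤ)) * |((2 ^ k) ^ Module.finrank ℝ (E d))⁻¹| = 1 := by
    rw [abs_of_pos (by positivity), finrank_euclideanSpace_fin, zpow_mul, zpow_natCast]
    exact mul_inv_cancel₀ (by positivity)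
  rw [h2, ENNReal.ofReal_one, one_mul]

end Cubes

/-! ### The self-improving bound for weighted suprema. -/

section WeightedSup

variable {d : ℕ}

/-- Decay of order d + 1 + N is split: d + 1 powers make an integrable kernel, and N powers are kept
to move the weight from x to y. -/
theorem exists_norm_dilate_le (ψ : 𝓢(E d, ℂ)) (N : ℕ) : ∃ A : ℝ, 0 ≤ A ∧ ∀ (k : ℤ) (z : E d),
    ‖dilate k ψ z‖ ≤ A * decayKernel d k z * ((1 + 2 ^ k * ‖z‖) ^ N)⁻¹ := by
  obtain ⟨A, hA0, hA⟩ := exists_one_add_norm_pow_mul_iteratedFDeriv_le ψ (d + 1 + N) 0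
  refine ⟨A, hA0, fun k z => ?_⟩
  have h0 : (0 : ℝ) < 2 ^ k := by positivity
  have h1 := hA ((2 : ℝ) ^ k • z)
  rw [norm_iteratedFDeriv_zero, norm_smul, Real.norm_of_nonneg h0.le] at h1
  have h2 : ‖ψ ((2 : ℝ) ^ k • z)‖ ≤ A * ((1 + 2 ^ k * ‖z‖) ^ (d + 1 + N))⁻¹ := by
    rw [← div_eq_mul_inv, le_div_iff₀ (by positivity), mul_comm]
    exact h1
  rw [dilate_apply, norm_smul, Real.norm_of_nonneg (by positivity)]
  calc _ ≤ (2 : ℝ) ^ (k * (d : ℤ)) * (A * ((1 + 2 ^ k * ‖z‖) ^ (d + 1 + N))⁻¹) := by gcongr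
    _ = _ := by rw [decayKernel, pow_add, mul_inv]; ring

/-- The weight `(1 + 2^k |x|)^{-N}`. -/
noncomputable def decayWeight (k : ℤ) (N : ℕ) (x : E d) : ℝ≥0∞ :=
  ENNReal.ofReal (((1 + 2 ^ k * ‖x‖) ^ N)⁻¹)

theorem decayWeight_le_one (k : ℤ) (N : ℕ) (x : E d) : decayWeight k N x ≤ 1 := by
  have h0 : (0 : ℝ) < 2 ^ k := by positivity
  refine ENNReal.ofReal_le_one.2 (inv_le_one_of_one_le₀ (one_le_pow₀ ?_))
  have := mul_nonneg h0.le (norm_nonneg x)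
  linarith

/-- Peetre's inequality: 1 + 2^k ‖·‖ is submultiplicative with respect to addition. -/
theorem inv_pow_mul_inv_pow_le (k : ℤ) (N : ℕ) (x y : E d) :
    ((1 + 2 ^ k * ‖x‖) ^ N)⁻¹ * ((1 + 2 ^ k * ‖x - y‖) ^ N)⁻¹ ≤
      (((1 + 2 ^ k * ‖y‖) ^ N)⁻¹ : ℝ) := by
  have h0 : (0 : ℝ) < 2 ^ k := by positivity
  rw [← mul_inv, ← mul_pow]
  gcongr
  have h1 : ‖y‖ ≤ ‖x‖ + ‖x - y‖ := by
    have := norm_sub_le x (x - y)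
    rwa [sub_sub_cancel] at this
  nlinarith [mul_le_mul_of_nonneg_left h1 h0.le, mul_nonneg (mul_nonneg h0.le (norm_nonneg x))
    (mul_nonneg h0.le (norm_nonneg (x - y)))]

/-- Weighted supremum bound for functions that are reproduced by convolution with `ψ_k`. -/
theorem exists_iSup_decayWeight_mul_le (ψ : 𝓢(E d, ℂ)) (N : ℕ) {r : ℝ} (hr : 0 < r) (hr1 : r ≤ 1) :
    ∃ K : ℝ≥0, 1 ≤ K ∧ ∀ (k : ℤ) (F : E d → ℂ), Continuous F →
      (∀ x, F x = ∫ y, dilate k ψ (x - y) * F y) → ∀ (x₀ : E d) (B : ℝ≥0∞),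
      (∀ n, ⨍⁻ y in dyadicCube k n, ‖F y‖ₑ ^ r ∂volume ≤ B ^ r) →
      ⨆ y, decayWeight k N (y - x₀) * ‖F y‖ₑ ≠ ∞ →
      ⨆ y, decayWeight k N (y - x₀) * ‖F y‖ₑ ≤ K * B := by
  obtain ⟨A, hA0, hA⟩ := exists_norm_dilate_le ψ N
  obtain ⟨I, hI⟩ := exists_lintegral_decayKernel_eq d
  -- The factors come from the decay of ψ, the oscillation of the kernel on a cube and the integral
  -- of the kernel; none depends on k, `F` or x₀.
  let L : ℝ≥0 := A.toNNReal * (((1 + √d) ^ (d + 1)).toNNReal * I)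
  refine ⟨max 1 (L ^ (1 / r)), le_max_left _ _, fun k F hFc hF x₀ B hB hS => ?_⟩
  set S := ⨆ y, decayWeight k N (y - x₀) * ‖F y‖ₑ with hSdef
  have hstep : S ≤ L * S ^ (1 - r) * B ^ r := by
    refine iSup_le fun x => ?_
    have hpt : ∀ y, decayWeight k N (x - x₀) * ‖dilate k ψ (x - y) * F y‖ₑ ≤
        (ENNReal.ofReal A * S ^ (1 - r)) *
          (ENNReal.ofReal (decayKernel d k (x - y)) * ‖F y‖ₑ ^ r) := fun y => by
      have h1 : decayWeight k N (x - x₀) * ‖dilate k ψ (x - y)‖ₑ ≤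
          ENNReal.ofReal A * ENNReal.ofReal (decayKernel d k (x - y)) *
            decayWeight k N (y - x₀) := by
        have hdk : 0 ≤ decayKernel d k (x - y) := by unfold decayKernel; positivity
        unfold decayWeight
        rw [← ofReal_norm, ← ENNReal.ofReal_mul (by positivity),
          ← ENNReal.ofReal_mul hA0, ← ENNReal.ofReal_mul (by positivity)]
        refine ENNReal.ofReal_le_ofReal ?_
        have h2 := inv_pow_mul_inv_pow_le k N (x - x₀) (y - x₀)
        rw [sub_sub_sub_cancel_right] at h2
        calc _ ≤ ((1 + 2 ^ k * ‖x - x₀‖) ^ N)⁻¹ *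
              (A * decayKernel d k (x - y) * ((1 + 2 ^ k * ‖x - y‖) ^ N)⁻¹) := by
              gcongr; exact hA k _
          _ = A * decayKernel d k (x - y) * (((1 + 2 ^ k * ‖x - x₀‖) ^ N)⁻¹ *
              ((1 + 2 ^ k * ‖x - y‖) ^ N)⁻¹) := by ring
          _ ≤ _ := by gcongr
      -- The power 1 - r of the weighted value is bounded by `S`, which needs r ≤ 1; in the power r
      -- the weight is simply bounded by 1.
      have h3 : decayWeight k N (y - x₀) * ‖F y‖ₑ ≤ S ^ (1 - r) * ‖F y‖ₑ ^ r := by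
        calc decayWeight k N (y - x₀) * ‖F y‖ₑ
            = (decayWeight k N (y - x₀) * ‖F y‖ₑ) ^ (1 - r) *
              (decayWeight k N (y - x₀) * ‖F y‖ₑ) ^ r := by
              rw [← ENNReal.rpow_add_of_nonneg _ _ (by linarith) hr.le, sub_add_cancel,
                ENNReal.rpow_one]
          _ ≤ S ^ (1 - r) * (1 * ‖F y‖ₑ) ^ r := by
              have : 0 ≤ 1 - r := by linarith
              gcongr
              · exact le_iSup (fun y => decayWeight k N (y - x₀) * ‖F y‖ₑ) y
              · exact decayWeight_le_one _ _ _
          _ = _ := by rw [one_mul]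
      rw [enorm_mul, ← mul_assoc]
      calc _ ≤ ENNReal.ofReal A * ENNReal.ofReal (decayKernel d k (x - y)) *
            decayWeight k N (y - x₀) * ‖F y‖ₑ := by gcongr
        _ = ENNReal.ofReal A * ENNReal.ofReal (decayKernel d k (x - y)) *
            (decayWeight k N (y - x₀) * ‖F y‖ₑ) := by ring
        _ ≤ ENNReal.ofReal A * ENNReal.ofReal (decayKernel d k (x - y)) *
            (S ^ (1 - r) * ‖F y‖ₑ ^ r) := by gcongr
        _ = _ := by ring
    have hFm : Measurable fun y => ‖F y‖ₑ ^ r := hFc.measurable.enorm.pow_const r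
    have hgm : Measurable fun y => ENNReal.ofReal (decayKernel d k (x - y)) :=
      ENNReal.measurable_ofReal.comp
        ((continuous_decayKernel k).comp (continuous_const.sub continuous_id)).measurable
    calc decayWeight k N (x - x₀) * ‖F x‖ₑ
        ≤ decayWeight k N (x - x₀) * ∫⁻ y, ‖dilate k ψ (x - y) * F y‖ₑ := by
          gcongr
          nth_rw 1 [hF x]
          exact enorm_integral_le_lintegral_enorm _
      _ = ∫⁻ y, decayWeight k N (x - x₀) * ‖dilate k ψ (x - y) * F y‖ₑ :=
          (lintegral_const_mul' _ _ ENNReal.ofReal_ne_top).symm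
      _ ≤ ∫⁻ y, (ENNReal.ofReal A * S ^ (1 - r)) *
          (ENNReal.ofReal (decayKernel d k (x - y)) * ‖F y‖ₑ ^ r) := lintegral_mono hpt
      _ = (ENNReal.ofReal A * S ^ (1 - r)) *
          ∫⁻ y, ENNReal.ofReal (decayKernel d k (x - y)) * ‖F y‖ₑ ^ r :=
          lintegral_const_mul _ (hgm.mul hFm)
      _ ≤ (ENNReal.ofReal A * S ^ (1 - r)) *
          (ENNReal.ofReal ((1 + √d) ^ (d + 1)) * I * B ^ r) := by
          gcongr
          refine (lintegral_mul_le_iSup_laverage k hFm (ENNReal.ofReal ((1 + √d) ^ (d + 1)))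
            (fun n y hy z hz => ?_) hgm).trans ?_
          · rw [← ENNReal.ofReal_mul (by positivity)]
            exact ENNReal.ofReal_le_ofReal (decayKernel_le x hy hz)
          · rw [hI]
            gcongr
            exact iSup_le hB
      _ = L * S ^ (1 - r) * B ^ r := by
          simp only [L, ENNReal.coe_mul, ENNReal.ofReal]
          ring
  -- Dividing by S^{1-r} is the only place where the a priori finiteness of `S` enters.
  have hSr : S ^ r ≤ L * B ^ r := by
    rcases eq_or_ne S 0 with h0 | h0
    · rw [h0, ENNReal.zero_rpow_of_pos hr]; exact zero_le
    · have h1 : S ^ (1 - r) * S ^ r = S := by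
        rw [← ENNReal.rpow_add _ _ h0 hS, sub_add_cancel, ENNReal.rpow_one]
      have h2 : S ^ (1 - r) * S ^ r ≤ S ^ (1 - r) * (L * B ^ r) := by
        rw [h1]; refine hstep.trans_eq ?_; ring
      exact (ENNReal.mul_le_mul_iff_right (ENNReal.rpow_pos h0.bot_lt hS).ne'
        (ENNReal.rpow_ne_top_of_nonneg (by linarith) hS)).1 h2
  calc S = (S ^ r) ^ (1 / r) := by
        rw [← ENNReal.rpow_mul, mul_one_div_cancel hr.ne', ENNReal.rpow_one]
    _ ≤ (L * B ^ r) ^ (1 / r) := by gcongr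
    _ = ((L ^ (1 / r) : ℝ≥0) : ℝ≥0∞) * B := by
        rw [ENNReal.mul_rpow_of_nonneg _ _ (by positivity), ← ENNReal.rpow_mul,
          mul_one_div_cancel hr.ne', ENNReal.rpow_one, ENNReal.coe_rpow_of_nonneg _ (by positivity)]
    _ ≤ _ := by
        gcongr
        exact le_max_right _ _

end WeightedSup

end TriebelLizorkinInfty

namespace TriebelLizorkinInfty

open Filter Topology

/-! ### Uniform bounds from averages over cubes. -/

section Core

variable {d : ℕ}

/-- A function of polynomial growth that is reproduced by convolution with `ψ_k` is bounded by its
averages over the dyadic cubes of side length `2^{-k}`. -/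
theorem exists_enorm_le_of_reproducing (ψ : 𝓢(E d, ℂ)) {q : ℝ} (hq : 0 < q) :
    ∃ K : ℝ≥0, 1 ≤ K ∧ ∀ (k : ℤ) (F : E d → ℂ), Continuous F →
      (∃ (C : ℝ) (N : ℕ), ∀ x, ‖F x‖ ≤ C * (1 + ‖x‖) ^ N) →
      (∀ x, F x = ∫ y, dilate k ψ (x - y) * F y) → ∀ B : ℝ≥0∞,
      (∀ n, (⨍⁻ y in dyadicCube k n, ‖F y‖ₑ ^ q ∂volume) ^ (1 / q) ≤ B) →
      ∀ x, ‖F x‖ₑ ≤ K * B := by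
  -- The self-improving bound needs an exponent at most 1; for q > 1, Hölder on each cube passes
  -- from q to 1.
  have hr : 0 < min q 1 := lt_min hq one_pos
  -- Weight order 0, chosen before `F`, so that the final constant does not see the growth order of
  -- `F`.
  obtain ⟨K, hK1, hK⟩ := exists_iSup_decayWeight_mul_le ψ 0 hr (min_le_right q 1)
  refine ⟨K, hK1, fun k F hFc ⟨C, N, hCN⟩ hF B hB => ?_⟩
  rcases eq_or_ne B ∞ with rfl | hBt
  · intro x
    rw [ENNReal.mul_top (by exact_mod_cast (zero_lt_one.trans_le hK1).ne')]
    exact le_top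
  have hBr : ∀ n, ⨍⁻ y in dyadicCube k n, ‖F y‖ₑ ^ (min q 1) ∂volume ≤ B ^ (min q 1) := by
    intro n
    have hQ : NeZero ((volume.restrict (dyadicCube (d := d) k n)) Set.univ) :=
      ⟨by rw [Measure.restrict_apply_univ]; exact volume_dyadicCube_ne_zero k n⟩
    have hQt : IsFiniteMeasure (volume.restrict (dyadicCube (d := d) k n)) :=
      ⟨by rw [Measure.restrict_apply_univ]; exact (volume_dyadicCube_ne_top k n).lt_top⟩
    have hne : NeZero (volume.restrict (dyadicCube (d := d) k n)) :=
      ⟨fun h => hQ.1 (by rw [h]; rfl)⟩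
    have h1 := eLpNorm'_le_eLpNorm'_of_exponent_le (f := F) hr (min_le_left q 1)
      (((volume.restrict (dyadicCube (d := d) k n)) Set.univ)⁻¹ •
        volume.restrict (dyadicCube (d := d) k n)) hFc.aestronglyMeasurable
    have h2 : (⨍⁻ y in dyadicCube k n, ‖F y‖ₑ ^ (min q 1) ∂volume) ^ (1 / min q 1) ≤ B :=
      h1.trans (hB n)
    calc _ = ((⨍⁻ y in dyadicCube k n, ‖F y‖ₑ ^ (min q 1) ∂volume) ^ (1 / min q 1)) ^ (min q 1) := by
          rw [← ENNReal.rpow_mul, one_div_mul_cancel hr.ne', ENNReal.rpow_one]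
      _ ≤ _ := by gcongr
  have h0 : (0 : ℝ) < 2 ^ k := by positivity
  -- With N the growth order of `F` the weighted supremum is finite. The resulting constant depends
  -- on N and serves only to show that `F` is bounded, the hypothesis of the pass with weight order
  -- 0.
  obtain ⟨K', -, hK'⟩ := exists_iSup_decayWeight_mul_le ψ N hr (min_le_right q 1)
  have hbdd : ∀ x, ‖F x‖ₑ ≤ K' * B := fun x => by
    have hle := hK' k F hFc hF x B hBr ?_
    · refine le_trans ?_ (le_trans (le_iSup _ x) hle)
      simp [decayWeight]
    · have : ∀ y, decayWeight k N (y - x) * ‖F y‖ₑ ≤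
          ENNReal.ofReal (|C| * ((1 + ‖x‖) * (1 + (2 ^ k)⁻¹)) ^ N) := fun y => by
        rw [decayWeight, ← ofReal_norm, ← ENNReal.ofReal_mul (by positivity)]
        refine ENNReal.ofReal_le_ofReal ?_
        rw [inv_mul_le_iff₀ (by positivity)]
        have h3 : 1 + ‖y‖ ≤ (1 + 2 ^ k * ‖y - x‖) * ((1 + ‖x‖) * (1 + (2 ^ k)⁻¹)) := by
          have h4 : ‖y‖ ≤ ‖y - x‖ + ‖x‖ := by
            have := norm_add_le (y - x) x
            rwa [sub_add_cancel] at this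
          have h5 : (2 ^ k * ‖y - x‖) * (2 ^ k)⁻¹ = ‖y - x‖ := by field_simp
          have h6 : 0 ≤ 2 ^ k * ‖y - x‖ := by positivity
          have h7 : (0 : ℝ) < (2 ^ k)⁻¹ := by positivity
          calc 1 + ‖y‖ ≤ 1 + ‖x‖ + (2 ^ k * ‖y - x‖) * (2 ^ k)⁻¹ := by rw [h5]; linarith
            _ ≤ _ := by
              have := norm_nonneg x
              have h8 : 0 ≤ 2 ^ k * ‖y - x‖ * ‖x‖ := by positivity
              have h9 : 0 ≤ 2 ^ k * ‖y - x‖ * ‖x‖ * (2 ^ k)⁻¹ := by positivity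
              have h10 : 0 ≤ ‖x‖ * (2 ^ k)⁻¹ := by positivity
              nlinarith
        calc ‖F y‖ ≤ |C| * (1 + ‖y‖) ^ N := (hCN y).trans (by gcongr; exact le_abs_self C)
          _ ≤ |C| * ((1 + 2 ^ k * ‖y - x‖) * ((1 + ‖x‖) * (1 + (2 ^ k)⁻¹))) ^ N := by gcongr
          _ = _ := by rw [mul_pow]; ring
      exact ((iSup_le this).trans_lt ENNReal.ofReal_lt_top).ne
  intro x
  have hw : ∀ y, decayWeight k 0 (y - x) = 1 := fun y => by simp [decayWeight]
  have hle := hK k F hFc hF x B hBr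
  simp only [hw, one_mul] at hle
  refine le_trans (le_iSup (fun y => ‖F y‖ₑ) x) (hle ?_)
  exact ((iSup_le hbdd).trans_lt (ENNReal.mul_lt_top ENNReal.coe_lt_top hBt.lt_top)).ne

end Core

/-! ### Reproducing formulas for band-limited distributions. -/

section Reproducing

variable {d : ℕ}

theorem fourier_dilate (k : ℤ) (ψ : 𝓢(E d, ℂ)) (ξ : E d) :
    (𝓕 (dilate k ψ) : 𝓢(E d, ℂ)) ξ = (𝓕 ψ : 𝓢(E d, ℂ)) (((2 : ℝ) ^ k)⁻¹ • ξ) := by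
  have h0 : (0 : ℝ) < 2 ^ k := by positivity
  rw [fourier_coe, fourier_coe, Real.fourier_eq, Real.fourier_eq]
  have h1 : ∀ v : E d, Real.fourierChar (-inner ℝ v ξ) • dilate k ψ v =
      ((2 : ℝ) ^ (k * (d : ℤ))) • (fun w : E d =>
        Real.fourierChar (-inner ℝ w (((2 : ℝ) ^ k)⁻¹ • ξ)) • ψ w) ((2 : ℝ) ^ k • v) := fun v => by
    rw [dilate_apply, smul_comm]
    congr 3
    rw [inner_smul_left, inner_smul_right, RCLike.conj_to_real, mul_inv_cancel_left₀ h0.ne']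
  rw [integral_congr_ae (ae_of_all _ h1), integral_smul,
    Measure.integral_comp_smul volume (fun w : E d =>
      Real.fourierChar (-inner ℝ w (((2 : ℝ) ^ k)⁻¹ • ξ)) • ψ w) ((2 : ℝ) ^ k), smul_smul]
  have h2 : (2 : ℝ) ^ (k * (d : ℤ)) * |((2 ^ k) ^ Module.finrank ℝ (E d))⁻¹| = 1 := by
    rw [abs_of_pos (by positivity), finrank_euclideanSpace_fin, zpow_mul, zpow_natCast]
    exact mul_inv_cancel₀ (by positivity)
  rw [h2, one_smul]

theorem exists_fourier_eq_one_on_closedBall (d : ℕ) {R : ℝ} (hR : 0 < R) :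
    ∃ ψ : 𝓢(E d, ℂ), ∀ ξ : E d, ‖ξ‖ ≤ R → (𝓕 ψ : 𝓢(E d, ℂ)) ξ = 1 := by
  let b : ContDiffBump (0 : E d) := ⟨R, R + 1, hR, by linarith⟩
  have hc : HasCompactSupport fun x => (b x : ℂ) :=
    b.hasCompactSupport.comp_left Complex.ofReal_zero
  refine ⟨𝓕⁻ (hc.toSchwartzMap (Complex.ofRealCLM.contDiff.comp b.contDiff)), fun ξ hξ => ?_⟩
  rw [FourierTransform.fourier_fourierInv_eq]
  change (b ξ : ℂ) = 1
  rw [b.one_of_mem_closedBall (by simpa [b] using hξ), Complex.ofReal_one]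

/-- Reflection `ψ(- ·)` of a Schwartz function. -/
noncomputable def reflect (ψ : 𝓢(E d, ℂ)) : 𝓢(E d, ℂ) :=
  compCLMOfContinuousLinearEquiv ℂ (ContinuousLinearEquiv.neg ℝ) ψ

theorem reflect_apply (ψ : 𝓢(E d, ℂ)) (x : E d) : reflect ψ x = ψ (-x) := rfl

theorem fourier_reflect (ψ : 𝓢(E d, ℂ)) (ξ : E d) :
    (𝓕 (reflect ψ) : 𝓢(E d, ℂ)) ξ = (𝓕 ψ : 𝓢(E d, ℂ)) (-ξ) := by
  have h := Real.fourier_comp_linearIsometry (LinearIsometryEquiv.neg ℝ (E := E d)) ψ ξ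
  rw [fourier_coe, fourier_coe]
  exact h

theorem apply_convolution_reflect (T : 𝓢'(E d, ℂ)) (η ψ : 𝓢(E d, ℂ)) :
    T (convolution (ContinuousLinearMap.mul ℂ ℂ) η (reflect ψ)) = ∫ x, η x * conv ψ T x :=
  apply_convolution (X := E d) T η (reflect ψ)

theorem continuous_conv (ψ : 𝓢(E d, ℂ)) (T : 𝓢'(E d, ℂ)) : Continuous (conv ψ T) :=
  T.continuous.comp (continuous_compSubConstCLM (reflect ψ))

theorem exists_norm_conv_le (ψ : 𝓢(E d, ℂ)) (T : 𝓢'(E d, ℂ)) :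
    ∃ (C : ℝ) (N : ℕ), ∀ x, ‖conv ψ T x‖ ≤ C * (1 + ‖x‖) ^ N := by
  obtain ⟨C, N, -, h⟩ := exists_norm_apply_compSubConstCLM_le (X := E d) T (reflect ψ)
  exact ⟨C, N, h⟩

/-- Associativity of convolution: `T` is taken out of the integral, and the remaining identity
between Schwartz functions is a translation of the integration variable. -/
theorem integral_mul_conv (θ η : 𝓢(E d, ℂ)) (T : 𝓢'(E d, ℂ)) (x : E d) :
    ∫ y, η (x - y) * conv θ T y =
      conv (convolution (ContinuousLinearMap.mul ℂ ℂ) θ η) T x := by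
  have h := apply_convolution_reflect T (reflectTranslate η x) θ
  simp only [reflectTranslate_apply] at h
  rw [← h, conv]
  congr 1
  ext z
  rw [reflectTranslate_apply, convolution_mul_apply, convolution_mul_apply,
    ← integral_sub_right_eq_self (fun w => θ w * η (x - z - w)) z]
  refine integral_congr_ae (ae_of_all _ fun y => ?_)
  simp only [reflectTranslate_apply, reflect_apply, neg_sub, sub_sub, add_sub_cancel,
    mul_comm]

/-- If `𝓕 ψ = 1` on the support of `𝓕 θ`, then `θ_k * T` is reproduced by `ψ_k`. -/
theorem conv_dilate_eq_integral {θ ψ : 𝓢(E d, ℂ)}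
    (h : ∀ ξ : E d, (𝓕 θ : 𝓢(E d, ℂ)) ξ * (𝓕 ψ : 𝓢(E d, ℂ)) ξ = (𝓕 θ : 𝓢(E d, ℂ)) ξ)
    (k : ℤ) (T : 𝓢'(E d, ℂ)) (x : E d) :
    conv (dilate k θ) T x = ∫ y, dilate k ψ (x - y) * conv (dilate k θ) T y := by
  rw [integral_mul_conv]
  congr 1
  refine (eq_of_fourier_eq ?_).symm
  rw [fourier_convolution]
  ext ξ
  rw [pairing_apply_apply, ContinuousLinearMap.mul_apply', fourier_dilate, fourier_dilate, h]

/-- A band-limited distribution is given by integration against its convolution with `ψ_k`. -/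
theorem apply_eq_integral_conv_dilate {A : ℝ} {ψ : 𝓢(E d, ℂ)}
    (hψ : ∀ ξ : E d, ‖ξ‖ ≤ 2 * A + 1 → (𝓕 ψ : 𝓢(E d, ℂ)) ξ = 1) (k : ℤ) {T : 𝓢'(E d, ℂ)}
    (hT : T ∈ bandLimited d (A * (2 : ℝ) ^ k)) (φ : 𝓢(E d, ℂ)) :
    T φ = ∫ x, φ x * conv (dilate k ψ) T x := by
  have h0 : (0 : ℝ) < 2 ^ k := by positivity
  rw [← apply_convolution_reflect]
  set φ' := convolution (ContinuousLinearMap.mul ℂ ℂ) φ (reflect (dilate k ψ)) with hφ'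
  have hT0 : (𝓕 T : 𝓢'(E d, ℂ)) (𝓕⁻ (φ - φ') : 𝓢(E d, ℂ)) = 0 := by
    refine apply_eq_zero_of_disjoint_dsupport (X := E d) (𝓕 T : 𝓢'(E d, ℂ)) _ ?_
    refine Disjoint.mono_right (hT : Distribution.dsupport (𝓕 T : 𝓢'(E d, ℂ)) ⊆ _) ?_
    -- The test function must vanish on an open neighbourhood of the spectrum, not merely on it. The
    -- extra 1 in 2A + 1 provides a margin of width 2^k around the ball of radius 2A · 2^k.
    have hopen : IsOpen (Metric.ball (0 : E d) ((2 * A + 1) * 2 ^ k)) := Metric.isOpen_ball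
    have hzero : Disjoint (Function.support (𝓕⁻ (φ - φ') : 𝓢(E d, ℂ)))
        (Metric.ball (0 : E d) ((2 * A + 1) * 2 ^ k)) := by
      refine Set.disjoint_right.2 fun ξ hξ hne => hne ?_
      have h1 : (𝓕⁻ (φ - φ') : 𝓢(E d, ℂ)) ξ = (𝓕 (φ - φ') : 𝓢(E d, ℂ)) (-ξ) := by
        rw [fourier_coe, fourierInv_coe]
        exact Real.fourierInv_eq_fourier_neg _ _
      have h2 : (𝓕 (φ - φ') : 𝓢(E d, ℂ)) = 𝓕 φ - 𝓕 φ' :=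
        map_sub (FourierTransform.fourierCLM ℂ 𝓢(E d, ℂ)) φ φ'
      rw [h1, h2, hφ', fourier_convolution, _root_.sub_apply,
        pairing_apply_apply, ContinuousLinearMap.mul_apply', fourier_reflect, neg_neg,
        fourier_dilate, hψ, mul_one, sub_self]
      rw [mem_ball_zero_iff] at hξ
      rw [norm_smul, norm_inv, Real.norm_of_nonneg h0.le, inv_mul_le_iff₀ h0, mul_comm]
      exact hξ.le
    refine (hzero.closure_left hopen).mono_right fun ξ hξ => ?_
    rw [mem_closedBall_zero_iff] at hξ
    rw [mem_ball_zero_iff]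
    linarith
  rw [TemperedDistribution.fourier_apply, FourierTransform.fourier_fourierInv_eq, map_sub] at hT0
  exact sub_eq_zero.1 hT0

/-- A function representing a tempered distribution is determined almost everywhere. -/
theorem IsRepresentedBy.ae_eq {T : 𝓢'(E d, ℂ)} {f F : E d → ℂ} (hf : IsRepresentedBy T f)
    (hFc : Continuous F) (hF : ∀ φ : 𝓢(E d, ℂ), T φ = ∫ x, φ x * F x) : f =ᵐ[volume] F := by
  -- Only products of `f` with Schwartz functions are known to be integrable; a bump function equal
  -- to 1 near x gives integrability of `f` there.
  have hloc : LocallyIntegrable f volume := fun x => by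
    let b : ContDiffBump x := ⟨1, 2, one_pos, one_lt_two⟩
    have hc : HasCompactSupport fun x => (b x : ℂ) :=
      b.hasCompactSupport.comp_left Complex.ofReal_zero
    have hi := (hf (hc.toSchwartzMap (Complex.ofRealCLM.contDiff.comp b.contDiff))).1
    refine ⟨Metric.closedBall x 1, Metric.closedBall_mem_nhds x one_pos, ?_⟩
    refine hi.integrableOn.congr_fun (fun y hy => ?_) Metric.isClosed_closedBall.measurableSet
    change (b y : ℂ) * f y = f y
    rw [b.one_of_mem_closedBall hy, Complex.ofReal_one, one_mul]
  refine ae_eq_of_integral_contDiff_smul_eq hloc hFc.locallyIntegrable fun g hg hgc => ?_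
  have hc : HasCompactSupport fun x => (g x : ℂ) := hgc.comp_left Complex.ofReal_zero
  let φ := hc.toSchwartzMap (Complex.ofRealCLM.contDiff.comp hg)
  have h := (hf φ).2.symm.trans (hF φ)
  simp only [Complex.real_smul]
  exact h

end Reproducing

end TriebelLizorkinInfty

/-! ### Comparison of the quantities V for different exponents. -/

namespace TriebelLizorkinInfty

open Filter Topology

variable {d : ℕ}

/-- Passing from the exponent `q₁` to `q₂` in an average of sums of functions bounded by `B`. -/
theorem laverage_tsum_rpow_le {ι α : Type*} [Countable ι] [MeasurableSpace α] (m : Measure α)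
    (a : ι → α → ℝ≥0∞) {q₁ q₂ : ℝ} (h₁ : 0 < q₁) (h₁₂ : q₁ < q₂) (B : ℝ≥0∞)
    (ha : ∀ i, ∀ᵐ x ∂m, a i x ≤ B)
    (hB : (⨍⁻ x, ∑' i, a i x ^ q₁ ∂m) ^ (1 / q₁) ≤ B) :
    (⨍⁻ x, ∑' i, a i x ^ q₂ ∂m) ^ (1 / q₂) ≤ B := by
  have h₂ : 0 < q₂ := h₁.trans h₁₂
  rcases eq_or_ne B ∞ with rfl | hBt
  · exact le_top
  have hc : B ^ (q₂ - q₁) ≠ ∞ := ENNReal.rpow_ne_top_of_nonneg (by linarith) hBt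
  have hB' : ⨍⁻ x, ∑' i, a i x ^ q₁ ∂m ≤ B ^ q₁ := by
    calc _ = ((⨍⁻ x, ∑' i, a i x ^ q₁ ∂m) ^ (1 / q₁)) ^ q₁ := by
          rw [← ENNReal.rpow_mul, one_div_mul_cancel h₁.ne', ENNReal.rpow_one]
      _ ≤ _ := by gcongr
  have hle : ⨍⁻ x, ∑' i, a i x ^ q₂ ∂m ≤ B ^ q₂ := by
    calc ⨍⁻ x, ∑' i, a i x ^ q₂ ∂m
        ≤ ⨍⁻ x, B ^ (q₂ - q₁) * ∑' i, a i x ^ q₁ ∂m := by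
          rw [laverage_eq, laverage_eq]
          refine ENNReal.div_le_div_right (lintegral_mono_ae ?_) _
          filter_upwards [ae_all_iff.2 ha] with x hx
          rw [← ENNReal.tsum_mul_left]
          refine ENNReal.tsum_le_tsum fun i => ?_
          have e : a i x ^ q₂ = a i x ^ (q₂ - q₁) * a i x ^ q₁ := by
            rw [← ENNReal.rpow_add_of_nonneg _ _ (by linarith) h₁.le, sub_add_cancel]
          rw [e]
          have : 0 ≤ q₂ - q₁ := by linarith
          gcongr
          exact hx i
      _ = B ^ (q₂ - q₁) * ⨍⁻ x, ∑' i, a i x ^ q₁ ∂m := by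
          rw [laverage_eq, laverage_eq, lintegral_const_mul' _ _ hc, mul_div_assoc]
      _ ≤ B ^ (q₂ - q₁) * B ^ q₁ := by gcongr
      _ = B ^ q₂ := by
          rw [← ENNReal.rpow_add_of_nonneg _ _ (by linarith) h₁.le, sub_add_cancel]
  calc _ ≤ (B ^ q₂) ^ (1 / q₂) := by gcongr
    _ = B := by rw [← ENNReal.rpow_mul, mul_one_div_cancel h₂.ne', ENNReal.rpow_one]

theorem rpow_laverage_tsum_le_V {μ : ℤ} (q : ℝ) (f : ℤ → E d → ℂ) {j : ℤ} (hj : μ ≤ j)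
    (n : Fin d → ℤ) :
    (⨍⁻ x in dyadicCube j n, ∑' k : Set.Ici j, ‖f k x‖ₑ ^ q ∂volume) ^ (1 / q) ≤ V μ q f :=
  le_iSup_of_le j (le_iSup_of_le hj (le_iSup (fun n : Fin d → ℤ =>
    (⨍⁻ x in dyadicCube j n, ∑' k : Set.Ici j, ‖f k x‖ₑ ^ q ∂volume) ^ (1 / q)) n))

/-- The uniform bound for band-limited functions in terms of `V`. -/
theorem exists_ae_enorm_le_V (d : ℕ) {A q : ℝ} (hA : 0 < A) (hq : 0 < q) :
    ∃ K : ℝ≥0, 1 ≤ K ∧ ∀ (μ : ℤ) (T : ℤ → 𝓢'(E d, ℂ)) (f : ℤ → E d → ℂ),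
      (∀ k : ℤ, T k ∈ bandLimited d (A * (2 : ℝ) ^ k) ∧ IsRepresentedBy (T k) (f k)) →
      ∀ k, μ ≤ k → ∀ᵐ x, ‖f k x‖ₑ ≤ K * V μ q f := by
  obtain ⟨ψ, hψ⟩ := exists_fourier_eq_one_on_closedBall d (R := 2 * A + 1) (by linarith)
  obtain ⟨K, hK1, hK⟩ := exists_enorm_le_of_reproducing ψ hq
  refine ⟨K, hK1, fun μ T f hT k hk => ?_⟩
  -- Used twice: it identifies `f k` almost everywhere with the continuous function ψ_k * T_k, and
  -- tested on ψ_k(x - ·) it is the reproducing formula for that function.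
  have hrep := apply_eq_integral_conv_dilate hψ k (hT k).1
  have hae := (hT k).2.ae_eq (continuous_conv (dilate k ψ) (T k)) hrep
  have hF := hK k _ (continuous_conv (dilate k ψ) (T k)) (exists_norm_conv_le _ _)
    (fun x => by
      have := hrep (reflectTranslate (dilate k ψ) x)
      simp only [reflectTranslate_apply] at this
      exact this) (V μ q f) fun n => by
    -- The cubes of side 2^{-k} are admissible since μ ≤ k, and the sum over such a cube starts
    -- exactly at k; only that term is kept.
    refine le_trans ?_ (rpow_laverage_tsum_le_V q f hk n)
    gcongr
    filter_upwards [hae] with x hx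
    rw [← hx]
    exact ENNReal.le_tsum (f := fun i : Set.Ici k => ‖f i x‖ₑ ^ q) ⟨k, Set.mem_Ici.2 le_rfl⟩
  filter_upwards [hae] with x hx
  rw [hx]
  exact hF x

/-- Since K ≥ 1, the number K V_{μ,q₁} dominates both the sup norms of the f_k with k ≥ μ and the
q₁-averages, so the interpolation returns the same constant. -/
theorem exists_V_le_V (d : ℕ) {A q₁ q₂ : ℝ} (hA : 0 < A) (h₁ : 0 < q₁) (h₁₂ : q₁ < q₂) :
    ∃ C : ℝ≥0, ∀ (μ : ℤ) (T : ℤ → 𝓢'(E d, ℂ)) (f : ℤ → E d → ℂ),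
      (∀ k : ℤ, T k ∈ bandLimited d (A * (2 : ℝ) ^ k) ∧ IsRepresentedBy (T k) (f k)) →
      V μ q₂ f ≤ (C : ℝ≥0∞) * V μ q₁ f := by
  obtain ⟨K, hK1, hK⟩ := exists_ae_enorm_le_V d hA h₁
  refine ⟨K, fun μ T f hT => iSup_le fun j => iSup_le fun hj => iSup_le fun n => ?_⟩
  refine laverage_tsum_rpow_le _ (fun (i : Set.Ici j) x => ‖f i x‖ₑ) h₁ h₁₂ _ (fun i => ?_) ?_
  · exact ae_restrict_of_ae (hK μ T f hT i (hj.trans i.2))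
  · exact (rpow_laverage_tsum_le_V q₁ f hj n).trans
      (le_mul_of_one_le_left' (by exact_mod_cast hK1))

/-! ### The embedding of the inhomogeneous spaces. -/

namespace LittlewoodPaley

variable (L : LittlewoodPaley d)

theorem fourier_φ_eq_zero {ξ : E d} (h : 2 < ‖ξ‖) : (𝓕 L.φ : 𝓢(E d, ℂ)) ξ = 0 :=
  image_eq_zero_of_notMem_tsupport fun hξ => (L.support_φ hξ).2.not_gt h

/-- The local part of the `F_∞^{s,q}` quasi-norm. -/
noncomputable def carlesonSup (s q : ℝ) (f : 𝓢'(E d, ℂ)) : ℝ≥0∞ :=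
  ⨆ (j : ℕ) (_ : 1 ≤ j) (n : Fin d → ℤ),
    (⨍⁻ x in dyadicCube (j : ℤ) n, ∑' k : Set.Ici j,
      ENNReal.ofReal ((2 : ℝ) ^ (s * (k : ℕ) * q)) * ‖L.Lam k f x‖ₑ ^ q ∂volume) ^ (1 / q)

theorem FNorm_of_ne_top (s : ℝ) {q : ℝ≥0∞} (hq : q ≠ ∞) (f : 𝓢'(E d, ℂ)) :
    L.FNorm s q f = eLpNorm (L.Lam 0 f) ∞ volume + L.carlesonSup s q.toReal f :=
  if_neg hq

/-- The weighted Littlewood-Paley piece `2^{sk} |Λ_k f|`. -/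
noncomputable def weightedLam (s : ℝ) (k : ℕ) (f : 𝓢'(E d, ℂ)) (x : E d) : ℝ≥0∞ :=
  ENNReal.ofReal ((2 : ℝ) ^ (s * k)) * ‖L.Lam k f x‖ₑ

theorem weightedLam_rpow (s : ℝ) {q : ℝ} (hq : 0 < q) (k : ℕ) (f : 𝓢'(E d, ℂ)) (x : E d) :
    L.weightedLam s k f x ^ q =
      ENNReal.ofReal ((2 : ℝ) ^ (s * k * q)) * ‖L.Lam k f x‖ₑ ^ q := by
  rw [weightedLam, ENNReal.mul_rpow_of_nonneg _ _ hq.le,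
    ENNReal.ofReal_rpow_of_pos (by positivity), ← Real.rpow_mul (by positivity)]

theorem rpow_laverage_tsum_le_carlesonSup (s : ℝ) {q : ℝ} (hq : 0 < q) (f : 𝓢'(E d, ℂ)) {j : ℕ}
    (hj : 1 ≤ j) (n : Fin d → ℤ) :
    (⨍⁻ x in dyadicCube (j : ℤ) n, ∑' k : Set.Ici j, L.weightedLam s k f x ^ q ∂volume) ^ (1 / q) ≤
      L.carlesonSup s q f := by
  simp only [L.weightedLam_rpow s hq]
  exact le_iSup_of_le j (le_iSup_of_le hj (le_iSup (fun n : Fin d → ℤ =>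
    (⨍⁻ x in dyadicCube (j : ℤ) n, ∑' k : Set.Ici j,
      ENNReal.ofReal ((2 : ℝ) ^ (s * (k : ℕ) * q)) * ‖L.Lam k f x‖ₑ ^ q ∂volume) ^ (1 / q)) n))

/-- The factor 2^{sk} is constant in x, so 2^{sk} Λ_k f satisfies the same reproducing formula as
Λ_k f; the cubes of side 2^{-k} are admissible because k ≥ 1. -/
theorem exists_weightedLam_le (s : ℝ) {q : ℝ} (hq : 0 < q) :
    ∃ K : ℝ≥0, 1 ≤ K ∧ ∀ (f : 𝓢'(E d, ℂ)) (k : ℕ), 1 ≤ k → ∀ x,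
      L.weightedLam s k f x ≤ K * L.carlesonSup s q f := by
  -- Radius 2 needs no margin here: the product of the transforms of φ and ψ is compared pointwise,
  -- without any support of a distribution.
  obtain ⟨ψ, hψ⟩ := exists_fourier_eq_one_on_closedBall d (R := 2) two_pos
  obtain ⟨K, hK1, hK⟩ := exists_enorm_le_of_reproducing ψ hq
  refine ⟨K, hK1, fun f k hk x => ?_⟩
  have hL : L.Lam k f = conv (dilate k L.φ) f := if_neg (by omega)
  let c : ℂ := ((2 : ℝ) ^ (s * k) : ℝ)
  have hc : ∀ y, ‖c * L.Lam k f y‖ₑ = L.weightedLam s k f y := fun y => by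
    rw [enorm_mul, weightedLam, ← ofReal_norm c, Complex.norm_of_nonneg (by positivity)]
  have hprod : ∀ ξ : E d, (𝓕 L.φ : 𝓢(E d, ℂ)) ξ * (𝓕 ψ : 𝓢(E d, ℂ)) ξ =
      (𝓕 L.φ : 𝓢(E d, ℂ)) ξ := fun ξ => by
    rcases le_or_gt ‖ξ‖ 2 with h | h
    · rw [hψ ξ h, mul_one]
    · rw [L.fourier_φ_eq_zero h, zero_mul]
  obtain ⟨C, N, hCN⟩ := exists_norm_conv_le (dilate k L.φ) f
  rw [← hc]
  refine hK k (fun y => c * L.Lam k f y) ?_ ⟨‖c‖ * C, N, fun y => ?_⟩ (fun y => ?_) _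
    (fun n => ?_) x
  · rw [hL]
    exact continuous_const.mul (continuous_conv _ _)
  · rw [norm_mul, hL, mul_assoc]
    gcongr
    exact hCN y
  · rw [hL, conv_dilate_eq_integral hprod, ← integral_const_mul]
    refine integral_congr_ae (ae_of_all _ fun z => ?_)
    ring
  · refine le_trans ?_ (L.rpow_laverage_tsum_le_carlesonSup s hq f hk n)
    gcongr
    refine ae_of_all _ fun y => ?_
    simp only [hc]
    exact ENNReal.le_tsum (f := fun i : Set.Ici k => L.weightedLam s i f y ^ q) ⟨k, Set.mem_Ici.2 le_rfl⟩

theorem exists_FNorm_le (s : ℝ) {q₁ q₂ : ℝ≥0∞} (h₁ : 0 < q₁) (h₁₂ : q₁ < q₂) :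
    ∃ C : ℝ≥0, ∀ f : 𝓢'(E d, ℂ), L.FNorm s q₂ f ≤ (C : ℝ≥0∞) * L.FNorm s q₁ f := by
  have h₁t : q₁ ≠ ∞ := h₁₂.ne_top
  have hq : 0 < q₁.toReal := ENNReal.toReal_pos h₁.ne' h₁t
  obtain ⟨K, hK1, hK⟩ := L.exists_weightedLam_le s hq
  have hK1' : (1 : ℝ≥0∞) ≤ K := by exact_mod_cast hK1
  refine ⟨K, fun f => ?_⟩
  rw [L.FNorm_of_ne_top s h₁t]
  rcases eq_or_ne q₂ ∞ with rfl | h₂t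
  · have hFN : L.FNorm s ∞ f = essSup (fun x => ⨆ k : ℕ, L.weightedLam s k f x) volume :=
      if_pos rfl
    rw [hFN]
    refine essSup_le_of_ae_le _ ?_
    filter_upwards [ae_le_eLpNormEssSup (f := L.Lam 0 f) (μ := volume)] with x hx
    refine iSup_le fun k => ?_
    rcases Nat.eq_zero_or_pos k with rfl | hk
    -- The piece k = 0 occurs in no cube sum, since l(P) < 1; it is controlled by the separate term
    -- ‖Λ_0 f‖_∞.
    · rw [weightedLam, Nat.cast_zero, mul_zero, Real.rpow_zero, ENNReal.ofReal_one, one_mul]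
      rw [eLpNorm_exponent_top]
      exact hx.trans (le_self_add.trans (le_mul_of_one_le_left' hK1'))
    · exact (hK f k hk x).trans (by gcongr; exact le_add_self)
  · rw [L.FNorm_of_ne_top s h₂t, mul_add]
    refine add_le_add (le_mul_of_one_le_left' hK1') ?_
    have hq₁₂ : q₁.toReal < q₂.toReal := (ENNReal.toReal_lt_toReal h₁t h₂t).2 h₁₂
    refine iSup_le fun j => iSup_le fun hj => iSup_le fun n => ?_
    simp only [← L.weightedLam_rpow s (hq.trans hq₁₂)]
    refine laverage_tsum_rpow_le _ (fun (i : Set.Ici j) x => L.weightedLam s i f x) hq hq₁₂ _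
      (fun i => ae_of_all _ fun x => hK f i (hj.trans i.2) x) ?_
    exact (L.rpow_laverage_tsum_le_carlesonSup s hq f hj n).trans (le_mul_of_one_le_left' hK1')

end LittlewoodPaley

end TriebelLizorkinInfty

theorem mainTheorem6 (d : ℕ) (hd : 1 ≤ d) :
    -- the comparison of `V_{μ,q₂}` with `V_{μ,q₁}`
    (∀ A q₁ q₂ : ℝ, 0 < A → 0 < q₁ → q₁ < q₂ →
      ∃ C : ℝ≥0, ∀ (μ : ℤ) (T : ℤ → 𝓢'(E d, ℂ))
        (f : ℤ → E d → ℂ),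
        (∀ k : ℤ, T k ∈ bandLimited d (A * (2 : ℝ) ^ k) ∧
          IsRepresentedBy (T k) (f k)) →
        V μ q₂ f ≤ (C : ℝ≥0∞) * V μ q₁ f) ∧
    -- the uniform bound
    (∀ A q : ℝ, 0 < A → 0 < q →
      ∃ C : ℝ≥0, ∀ (μ : ℤ) (T : ℤ → 𝓢'(E d, ℂ))
        (f : ℤ → E d → ℂ),
        (∀ k : ℤ, T k ∈ bandLimited d (A * (2 : ℝ) ^ k) ∧
          IsRepresentedBy (T k) (f k)) →
        (⨆ (k : ℤ) (_ : μ ≤ k), eLpNorm (f k) ∞ volume) ≤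
          (C : ℝ≥0∞) * V μ q f) ∧
    -- the embedding of the inhomogeneous spaces
    (∀ (L : LittlewoodPaley d) (s : ℝ) (q₁ q₂ : ℝ≥0∞),
      0 < q₁ → q₁ < q₂ →
      L.FSpace s q₁ ⊆ L.FSpace s q₂ ∧
      ∃ C : ℝ≥0, ∀ f : 𝓢'(E d, ℂ),
        L.FNorm s q₂ f ≤ (C : ℝ≥0∞) * L.FNorm s q₁ f) := by
  refine ⟨fun A q₁ q₂ hA h₁ h₁₂ => exists_V_le_V d hA h₁ h₁₂, fun A q hA hq => ?_,
    fun L s q₁ q₂ h₁ h₁₂ => ?_⟩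
  · obtain ⟨K, -, hK⟩ := exists_ae_enorm_le_V d hA hq
    refine ⟨K, fun μ T f hT => iSup_le fun k => iSup_le fun hk => ?_⟩
    rw [eLpNorm_exponent_top]
    exact essSup_le_of_ae_le _ (hK μ T f hT k hk)
  · obtain ⟨C, hC⟩ := L.exists_FNorm_le s h₁ h₁₂
    exact ⟨fun f hf => (hC f).trans_lt (ENNReal.mul_lt_top ENNReal.coe_lt_top hf), C, hC⟩
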